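/- Let $q\in\mathbb C^*$ be not a root of unity. Let $U_q(\mathfrak s)$ be the quantum Schrödinger algebra: the associative unital $\mathbb C$-algebra with generators $E,F,K,K^{-1},X,Y,Z$ and relations $KK^{-1}=K^{-1}K=1$, $Z$ central, $$EF-FE=\tfrac{K-K^{-1}}{q-q^{-1}},\quad KXK^{-1}=qX,\quad KEK^{-1}=q^2E,\quad KFK^{-1}=q^{-2}F,\quad KYK^{-1}=q^{-1}Y,$$ $$qYX-XY=Z,\quad EX=qXE,\quad EY=X+q^{-1}YE,\quad FX=YK^{-1}+XF,\quad FY=YF.$$ For $\lambda\in\mathbb C^*$ and $\dot z\in\mathbb C$ let the Verma module $\Delta(\lambda,\dot z)$ be the quotient of $U_q(\mathfrak s)$ by the left ideal generated by $E$, $X$, $K-\lambda$, $Z-\dot z$. Put $C=FE+\frac{qK+q^{-1}K^{-1}}{(q-q^{-1})^2}$ and $$\tilde C=Z\Big((1+q^{-1})C+\tfrac{1}{q^2-1}K^{-1}\Big)+X^2F-Y^2EK^{-1}+XY(q^{-1}FE-qEF),$$ a central element, which acts on the generating highest weight vector of $\Delta(\lambda,\dot z)$ by the scalar $\tilde c_\lambda=\frac{\dot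 z}{(q-q^{-1})^2}\big((q+q^2)\lambda+(q^{-1}+q^{-2})\lambda^{-1}\big)$. The category $\mathcal O$ consists of the finitely generated $U_q(\mathfrak s)$-modules $M$ that are the direct sum of the weight spaces $M_\lambda=\{v\in M: Kv=\lambda v\}$, $\lambda\in\mathbb C^*$, and on which the subalgebra $U_q(\mathfrak n^+)$ generated by $E$ and $X$ acts locally finitely. For $\dot c,\dot z\in\mathbb C$ let $\mathcal O^{\mathrm{gen}}[q^{\mathbb Z},\dot c,\dot z]$ be the full subcategory of those $M\in\mathcal O$ with $\{\lambda\in\mathbb C^*: M_\lambda\neq0\}\subseteq q^{\mathbb Z}$ that are annihilated by some power of the ideal $\langle\tilde C-\dot c,\,Z-\dot z\rangle$ of $\mathbb C[Z,\tilde C]$. Let the block $\mathcal O[q^{\mathbb Z},\dot c,\dot z]$ be its full subcategory of modules with central charge $\dot z$, i.e. on which $Z$ acts as the scalar $\dot z$. **Proposition.** Let $\dot z\neq0$. Then the following hold for every $n\in\mathbb Z$. 1. The Verma module $\Delta(q^n,\dot z)$ is simple. 2. The modules $\Delta(q^n,\dot z)$ and $\Delta(q^{-n-3},\dot z)$ are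 non-isomorphic simple objects of $\mathcal O[q^{\mathbb Z},\tilde c_{q^n},\dot z]$, and every simple object of $\mathcal O^{\mathrm{gen}}[q^{\mathbb Z},\tilde c_{q^n},\dot z]$ (in particular of the block) is isomorphic to one of them. 3. Every object of the block $\mathcal O[q^{\mathbb Z},\tilde c_{q^n},\dot z]$ is a semisimple module, and this block is equivalent, as a $\mathbb C$-linear category, to the category $(\mathbb C\oplus\mathbb C)$-mod of finitely generated modules over $\mathbb C\oplus\mathbb C$. -/

import Mathlib

open CategoryTheory

noncomputable section

namespace QuantumSchrodinger

/-- The generators `E, F, K, K⁻¹, X, Y, Z`. -/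
inductive Gen : Type
  | E | F | K | Kinv | X | Y | Z

open FreeAlgebra in
/-- The defining relations of the quantum Schrödinger algebra `U_q(𝔰)`. -/
inductive Rel (q : ℂ) : FreeAlgebra ℂ Gen → FreeAlgebra ℂ Gen → Prop
  | K_Kinv : Rel q (ι ℂ Gen.K * ι ℂ Gen.Kinv) 1
  | Kinv_K : Rel q (ι ℂ Gen.Kinv * ι ℂ Gen.K) 1
  | E_F : Rel q (ι ℂ Gen.E * ι ℂ Gen.F - ι ℂ Gen.F * ι ℂ Gen.E)
      ((q - q⁻¹)⁻¹ • (ι ℂ Gen.K - ι ℂ Gen.Kinv))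
  | K_X : Rel q (ι ℂ Gen.K * ι ℂ Gen.X * ι ℂ Gen.Kinv) (q • ι ℂ Gen.X)
  | K_E : Rel q (ι ℂ Gen.K * ι ℂ Gen.E * ι ℂ Gen.Kinv) (q ^ 2 • ι ℂ Gen.E)
  | K_F : Rel q (ι ℂ Gen.K * ι ℂ Gen.F * ι ℂ Gen.Kinv) ((q ^ 2)⁻¹ • ι ℂ Gen.F)
  | K_Y : Rel q (ι ℂ Gen.K * ι ℂ Gen.Y * ι ℂ Gen.Kinv) (q⁻¹ • ι ℂ Gen.Y)
  | Y_X : Rel q (q • (ι ℂ Gen.Y * ι ℂ Gen.X) - ι ℂ Gen.X * ι ℂ Gen.Y) (ι ℂ Gen.Z)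
  | E_X : Rel q (ι ℂ Gen.E * ι ℂ Gen.X) (q • (ι ℂ Gen.X * ι ℂ Gen.E))
  | E_Y : Rel q (ι ℂ Gen.E * ι ℂ Gen.Y) (ι ℂ Gen.X + q⁻¹ • (ι ℂ Gen.Y * ι ℂ Gen.E))
  | F_X : Rel q (ι ℂ Gen.F * ι ℂ Gen.X) (ι ℂ Gen.Y * ι ℂ Gen.Kinv + ι ℂ Gen.X * ι ℂ Gen.F)
  | F_Y : Rel q (ι ℂ Gen.F * ι ℂ Gen.Y) (ι ℂ Gen.Y * ι ℂ Gen.F)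
  | Z_central (g : Gen) : Rel q (ι ℂ Gen.Z * ι ℂ g) (ι ℂ g * ι ℂ Gen.Z)

/-- The quantum Schrödinger algebra `U_q(𝔰)` over `ℂ`. -/
def Uq (q : ℂ) : Type := RingQuot (Rel q)

instance (q : ℂ) : Ring (Uq q) := inferInstanceAs (Ring (RingQuot (Rel q)))

instance (q : ℂ) : Algebra ℂ (Uq q) := inferInstanceAs (Algebra ℂ (RingQuot (Rel q)))

/-- The quotient map from the free algebra to `U_q(𝔰)`. -/
def toUq (q : ℂ) : FreeAlgebra ℂ Gen →ₐ[ℂ] Uq q := RingQuot.mkAlgHom ℂ (Rel q)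

/-- The image of a generator in `U_q(𝔰)`. -/
def gen (q : ℂ) (g : Gen) : Uq q := toUq q (FreeAlgebra.ι ℂ g)

abbrev E (q : ℂ) : Uq q := gen q Gen.E
abbrev F (q : ℂ) : Uq q := gen q Gen.F
abbrev K (q : ℂ) : Uq q := gen q Gen.K
abbrev Kinv (q : ℂ) : Uq q := gen q Gen.Kinv
abbrev X (q : ℂ) : Uq q := gen q Gen.X
abbrev Y (q : ℂ) : Uq q := gen q Gen.Y
abbrev Z (q : ℂ) : Uq q := gen q Gen.Z

/-- `U_q(𝔫⁺)`, the subalgebra generated by `E` and `X`. -/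
def nPlus (q : ℂ) : Subalgebra ℂ (Uq q) := Algebra.adjoin ℂ {E q, X q}

/-- The Casimir element `C = FE + (qK + q⁻¹K⁻¹)/(q - q⁻¹)²` of `U_q(𝔰𝔩₂)`. -/
def casimir (q : ℂ) : Uq q :=
  F q * E q + ((q - q⁻¹) ^ 2)⁻¹ • (q • K q + q⁻¹ • Kinv q)

/-- The central element
`C̃ = Z((1+q⁻¹)C + K⁻¹/(q²-1)) + X²F - Y²EK⁻¹ + XY(q⁻¹FE - qEF)` of `U_q(𝔰)`. -/
def casimirTilde (q : ℂ) : Uq q :=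
  Z q * ((1 + q⁻¹) • casimir q + (q ^ 2 - 1)⁻¹ • Kinv q)
    + X q ^ 2 * F q - Y q ^ 2 * E q * Kinv q
    + X q * Y q * (q⁻¹ • (F q * E q) - q • (E q * F q))

section Modules

variable (q : ℂ) (M : Type) [AddCommGroup M] [Module ℂ M] [Module (Uq q) M]
  [IsScalarTower ℂ (Uq q) M]

/-- The weight space `M_l = {v | K v = l v}`. -/
def weightSpace (l : ℂ) : Submodule ℂ M :=
  Module.End.eigenspace (Algebra.lsmul ℂ ℂ M (K q)) l

open scoped Classical in
/-- `M` is the direct sum of its weight spaces `M_l`, `l ∈ ℂ*`. -/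
def IsWeightModule : Prop :=
  DirectSum.IsInternal (fun l : ℂˣ => weightSpace q M (l : ℂ))

/-- The support of `M`. -/
def supp : Set ℂ := {l | l ≠ 0 ∧ weightSpace q M l ≠ ⊥}

/-- `U_q(𝔫⁺) v` is finite-dimensional for each `v`. -/
def IsLocallyFinite : Prop :=
  ∀ v : M, FiniteDimensional ℂ
    ((Subalgebra.toSubmodule (nPlus q)).map
      ((LinearMap.toSpanSingleton (Uq q) M v).restrictScalars ℂ))

/-- Membership in the BGG category `𝒪` of `U_q(𝔰)`. -/
structure IsInO : Prop where
  finite : Module.Finite (Uq q) M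
  weight : IsWeightModule q M
  locallyFinite : IsLocallyFinite q M

/-- `M` is annihilated by some power of the ideal `⟨C̃ - c, Z - z⟩` of `ℂ[Z, C̃]`: the `m`-th
power of this ideal is generated by the products `(C̃ - c)^i (Z - z)^j` with `i + j = m`. -/
def IsAnnihilatedByPower (c z : ℂ) : Prop :=
  ∃ m : ℕ, ∀ i j : ℕ, i + j = m → ∀ v : M,
    ((casimirTilde q - algebraMap ℂ (Uq q) c) ^ i * (Z q - algebraMap ℂ (Uq q) z) ^ j) • v = 0

/-- `M` has central charge `z`: the central element `Z` acts as the scalar `z`. -/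
def HasCentralCharge (z : ℂ) : Prop := ∀ v : M, Z q • v = z • v

/-- `M` lies in `𝒪`, has support in `q^ℤ`, and is annihilated by some power of
`⟨C̃ - c, Z - z⟩` (so that `Z - z` is only required to act nilpotently). -/
structure IsInGenBlock (c z : ℂ) : Prop where
  inO : IsInO q M
  supp_subset : supp q M ⊆ Set.range (fun k : ℤ => q ^ k)
  annihilated : IsAnnihilatedByPower q M c z

/-- Membership in the block `𝒪[q^ℤ, c, z]` of modules with central charge `z`. -/
structure IsInBlock (c z : ℂ) : Prop extends IsInGenBlock q M c z where
  centralCharge : HasCentralCharge q M z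

end Modules

/-- The Verma module `Δ(l, z)`: the quotient of `U_q(𝔰)` by the left ideal generated by
`E`, `X`, `K - l` and `Z - z`. -/
abbrev Verma (q l z : ℂ) : Type :=
  Uq q ⧸ Submodule.span (Uq q)
    ({E q, X q, K q - algebraMap ℂ (Uq q) l, Z q - algebraMap ℂ (Uq q) z} : Set (Uq q))

/-- The generating highest weight vector of `Δ(l, z)`. -/
def highestVector (q l z : ℂ) : Verma q l z := Submodule.Quotient.mk 1

/-- The scalar `c̃_l` by which `C̃` acts on a highest weight vector of weight `l` and central
charge `z`; see `casimirTilde_smul_highestVector`. -/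
def centralValue (q l z : ℂ) : ℂ :=
  z / (q - q⁻¹) ^ 2 * ((q + q ^ 2) * l + (q⁻¹ + (q ^ 2)⁻¹) * l⁻¹)

section CentralValue

variable {q : ℂ} {M : Type} [AddCommGroup M] [Module ℂ M] [Module (Uq q) M]
  [IsScalarTower ℂ (Uq q) M]

theorem casimirTilde_smul_of_highest (hq0 : q ≠ 0) (hq2 : q ^ 2 ≠ 1) {l z : ℂ} (hl : l ≠ 0)
    {v : M} (hE : E q • v = 0) (hX : X q • v = 0) (hK : K q • v = l • v)
    (hZ : Z q • v = z • v) :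
    casimirTilde q • v = centralValue q l z • v := by
  have rel : ∀ {a b}, Rel q a b → toUq q a = toUq q b :=
    fun h => RingQuot.mkAlgHom_rel ℂ h
  have comm : ∀ (a : ℂ) (u : Uq q) (w : M), u • (a • w) = a • (u • w) :=
    fun a u w => smul_algebra_smul_comm a u w
  have hKi : Kinv q • v = l⁻¹ • v := by
    have h := rel (Rel.Kinv_K (q := q))
    simp only [map_mul, map_one] at h
    have h2 : (Kinv q * K q) • v = v := by
      rw [show Kinv q * K q = 1 from h, one_smul]
    rw [mul_smul, hK, comm] at h2
    calc Kinv q • v = l⁻¹ • l • Kinv q • v := by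
          rw [smul_smul, inv_mul_cancel₀ hl, one_smul]
      _ = l⁻¹ • v := by rw [h2]
  have hEF : E q • F q • v = ((q - q⁻¹)⁻¹ * (l - l⁻¹)) • v := by
    have h := rel (Rel.E_F (q := q))
    simp only [map_mul, map_sub, map_smul] at h
    have h2 : (E q * F q - F q * E q) • v = ((q - q⁻¹)⁻¹ • (K q - Kinv q)) • v := by
      rw [show E q * F q - F q * E q = (q - q⁻¹)⁻¹ • (K q - Kinv q) from h]
    rw [sub_smul, mul_smul, mul_smul, hE, smul_zero, sub_zero, smul_assoc, sub_smul, hK, hKi,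
      ← sub_smul] at h2
    rw [h2, smul_smul]
  have hXY : X q • Y q • v = (-z) • v := by
    have h := rel (Rel.Y_X (q := q))
    simp only [map_mul, map_sub, map_smul] at h
    have h2 : (q • (Y q * X q) - X q * Y q) • v = Z q • v := by
      rw [show q • (Y q * X q) - X q * Y q = Z q from h]
    rw [sub_smul, smul_assoc, mul_smul, mul_smul, hX, smul_zero, smul_zero, zero_sub, hZ] at h2
    rw [neg_smul, ← h2, neg_neg]
  have hXF : X q • F q • v = (-l⁻¹) • Y q • v := by
    have h := rel (Rel.F_X (q := q))
    simp only [map_mul, map_add] at h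
    have h2 : (F q * X q) • v = (Y q * Kinv q + X q * F q) • v := by
      rw [show F q * X q = Y q * Kinv q + X q * F q from h]
    rw [add_smul, mul_smul, mul_smul, mul_smul, hX, smul_zero, hKi, comm] at h2
    rw [neg_smul]
    exact (neg_eq_of_add_eq_zero_right h2.symm).symm
  have hd : q - q⁻¹ ≠ 0 := by
    intro h
    apply hq2
    field_simp at h
    linear_combination h
  have hd' : q ^ 2 - 1 ≠ 0 := sub_ne_zero.mpr hq2
  rw [casimirTilde, casimir]
  simp only [add_smul, sub_smul, mul_smul, smul_assoc, pow_two, one_smul, hE, hKi, hK,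
    hXF, hEF, comm, hXY, hZ, smul_zero, smul_add, smul_sub, smul_neg, zero_add, add_zero, sub_zero, zero_sub]
  simp only [smul_smul, ← add_smul, ← sub_smul, ← neg_smul]
  congr 1
  rw [centralValue]
  have e : q - q⁻¹ = (q ^ 2 - 1) / q := by field_simp
  have hd2 : q * q - 1 ≠ 0 := by rw [← pow_two]; exact hd'
  rw [e]
  field_simp
  ring

/-- `C̃` acts on the generator of `Δ(l, z)` (hence on that of each quotient) by `c̃_l`. -/
theorem casimirTilde_smul_highestVector (hq0 : q ≠ 0) (hq2 : q ^ 2 ≠ 1) {l : ℂ} (hl : l ≠ 0)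
    (z : ℂ) :
    casimirTilde q • highestVector q l z = centralValue q l z • highestVector q l z := by
  have key : ∀ (u : Uq q) (a : ℂ), u - algebraMap ℂ (Uq q) a ∈ Submodule.span (Uq q)
      ({E q, X q, K q - algebraMap ℂ (Uq q) l, Z q - algebraMap ℂ (Uq q) z} : Set (Uq q)) →
      u • highestVector q l z = a • highestVector q l z := by
    intro u a h
    rw [← algebraMap_smul (Uq q) a (highestVector q l z), highestVector,
      ← Submodule.Quotient.mk_smul, ← Submodule.Quotient.mk_smul, Submodule.Quotient.eq]
    simpa using h
  refine casimirTilde_smul_of_highest (M := Verma q l z) (z := z) hq0 hq2 hl ?_ ?_ ?_ ?_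
  · simpa using key (E q) 0 (by simpa using Submodule.subset_span (by simp))
  · simpa using key (X q) 0 (by simpa using Submodule.subset_span (by simp))
  · exact key _ _ (Submodule.subset_span (by simp))
  · exact key _ _ (Submodule.subset_span (by simp))

end CentralValue

open scoped ModuleCat in
/-- The block `𝒪[q^ℤ, c, z]` as a property of objects of the category of `U_q(𝔰)`-modules. -/
def blockProperty (q c z : ℂ) : ObjectProperty (ModuleCat.{0} (Uq q)) :=
  fun M => IsInBlock q M c z

/-- The block `𝒪[q^ℤ, c, z]` as a full subcategory of the category of `U_q(𝔰)`-modules. -/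
abbrev Block (q c z : ℂ) : Type 1 := (blockProperty q c z).FullSubcategory

end QuantumSchrodinger

end

open CategoryTheory

noncomputable section

namespace QuantumSchrodinger

/-! Write F' for the operator `lowering q z`. As z ≠ 0 and q is not a root of unity, `X` acts on the
vectors `Y ^ j • v` with `X • v = 0` as a q-derivative with nonzero coefficients. Hence a weight
module on which `X` is locally nilpotent is recovered from ker X by applying powers of `Y`
(`X_pow_smul_Y_pow`). On ker X there remains a rank one structure like that of quantum sl₂: `E`, `K`
and, on weight vectors, F' preserve it, and C̃ acts on its part of weight l as (1 + q) F'E + c̃_l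
(`casimirTilde_smul_of_X_smul_eq_zero`).

The difference of the central values at q^m and q^n factors through (q^m - q^n)(q^3 - q^(-m-n)), so
they agree exactly when m = n or m = -n - 3 (`centralValue_eq_iff`). But `E` and F' shift the
exponent of the weight by 2, while n and -n - 3 differ by the odd number 2n + 3. So the two highest
weights allowed by a central value never lie on one string of ker X, and everything follows from
this parity.

Simplicity: a nonzero submodule of a Verma module contains a highest weight vector; its weight is on
the string of n and has the same central value, so it is a multiple of the generator
(`isSimpleModule_verma`). That the generator is nonzero is seen in an explicit representation
(`highestVector_ne_zero`).

Semisimplicity: below the top of a string, C̃ - c is (1 + q) F'E plus a nonzero scalar, and it is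
nilpotent. So each vector of ker X lies in the submodule generated by the top of its string
(`IsAdmissible.mem_span_of_X_smul_eq_zero`), and the module is generated by its highest weight
vectors of the two weights (`IsAdmissible.span_eq_top`). Each nonzero one generates a simple Verma
module.

The equivalence sends a module to its two spaces of highest weight vectors, regarded as a module
over ℂ × ℂ. -/

theorem toUq_surjective (q : ℂ) : Function.Surjective (toUq q) :=
  RingQuot.mkAlgHom_surjective ℂ (Rel q)

theorem toUq_eq_of_rel {q : ℂ} {a b : FreeAlgebra ℂ Gen} (h : Rel q a b) : toUq q a = toUq q b :=
  RingQuot.mkAlgHom_rel ℂ h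

theorem sub_inv_ne_zero {q : ℂ} (hq0 : q ≠ 0) (hq2 : q ^ 2 ≠ 1) : q - q⁻¹ ≠ 0 := by
  intro h
  apply hq2
  field_simp at h
  linear_combination h

/-! ### The defining relations as operator identities, and commutation of C̃ with Y and F. -/

section Action

set_option linter.unusedSectionVars false
set_option linter.unusedSimpArgs false

variable {q : ℂ} {M : Type} [AddCommGroup M] [Module ℂ M] [Module (Uq q) M]
  [IsScalarTower ℂ (Uq q) M]

theorem uq_smul_comm (a : ℂ) (u : Uq q) (w : M) : u • (a • w) = a • (u • w) :=
  smul_algebra_smul_comm a u w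

theorem K_Kinv_smul (v : M) : K q • Kinv q • v = v := by
  have h := toUq_eq_of_rel (Rel.K_Kinv (q := q))
  simp only [map_mul, map_one] at h
  rw [← mul_smul, show K q * Kinv q = 1 from h, one_smul]

theorem Kinv_K_smul (v : M) : Kinv q • K q • v = v := by
  have h := toUq_eq_of_rel (Rel.Kinv_K (q := q))
  simp only [map_mul, map_one] at h
  rw [← mul_smul, show Kinv q * K q = 1 from h, one_smul]

theorem E_F_smul (v : M) :
    E q • F q • v = F q • E q • v + (q - q⁻¹)⁻¹ • (K q • v - Kinv q • v) := by
  have h := toUq_eq_of_rel (Rel.E_F (q := q))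
  simp only [map_mul, map_sub, map_smul] at h
  have h2 := congrArg (· • v) (show E q * F q - F q * E q = (q - q⁻¹)⁻¹ • (K q - Kinv q) from h)
  simp only [sub_smul, mul_smul, smul_assoc] at h2
  rw [← h2]; abel

theorem conj_smul {g : Gen} {a : ℂ} (h : Rel q (FreeAlgebra.ι ℂ Gen.K * FreeAlgebra.ι ℂ g *
      FreeAlgebra.ι ℂ Gen.Kinv) (a • FreeAlgebra.ι ℂ g)) (v : M) :
    K q • gen q g • v = a • gen q g • K q • v := by
  have h := toUq_eq_of_rel h
  simp only [map_mul, map_smul] at h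
  have h2 := congrArg (· • K q • v) (show K q * gen q g * Kinv q = a • gen q g from h)
  simpa only [mul_smul, smul_assoc, Kinv_K_smul] using h2

theorem Kinv_conj_smul {g : Gen} {a : ℂ} (ha : a ≠ 0) (h : Rel q (FreeAlgebra.ι ℂ Gen.K *
      FreeAlgebra.ι ℂ g * FreeAlgebra.ι ℂ Gen.Kinv) (a • FreeAlgebra.ι ℂ g)) (v : M) :
    Kinv q • gen q g • v = a⁻¹ • gen q g • Kinv q • v := by
  have h2 := congrArg (Kinv q • ·) (conj_smul h (Kinv q • v))
  rw [Kinv_K_smul, K_Kinv_smul, uq_smul_comm] at h2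
  rw [h2, inv_smul_smul₀ ha]

theorem K_X_smul (v : M) : K q • X q • v = q • X q • K q • v := conj_smul Rel.K_X v
theorem K_E_smul (v : M) : K q • E q • v = q ^ 2 • E q • K q • v := conj_smul Rel.K_E v
theorem K_F_smul (v : M) : K q • F q • v = (q ^ 2)⁻¹ • F q • K q • v := conj_smul Rel.K_F v
theorem K_Y_smul (v : M) : K q • Y q • v = q⁻¹ • Y q • K q • v := conj_smul Rel.K_Y v

theorem Kinv_X_smul (hq : q ≠ 0) (v : M) : Kinv q • X q • v = q⁻¹ • X q • Kinv q • v :=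
  Kinv_conj_smul hq Rel.K_X v
theorem Kinv_E_smul (hq : q ≠ 0) (v : M) : Kinv q • E q • v = (q ^ 2)⁻¹ • E q • Kinv q • v :=
  Kinv_conj_smul (pow_ne_zero 2 hq) Rel.K_E v
theorem Kinv_F_smul (hq : q ≠ 0) (v : M) : Kinv q • F q • v = q ^ 2 • F q • Kinv q • v := by
  simpa using Kinv_conj_smul (inv_ne_zero (pow_ne_zero 2 hq)) Rel.K_F v
theorem Kinv_Y_smul (hq : q ≠ 0) (v : M) : Kinv q • Y q • v = q • Y q • Kinv q • v := by
  simpa using Kinv_conj_smul (inv_ne_zero hq) Rel.K_Y v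

theorem X_Y_smul (v : M) : X q • Y q • v = q • Y q • X q • v - Z q • v := by
  have h := toUq_eq_of_rel (Rel.Y_X (q := q))
  simp only [map_mul, map_sub, map_smul] at h
  have h2 := congrArg (· • v) (show q • (Y q * X q) - X q * Y q = Z q from h)
  simp only [sub_smul, mul_smul, smul_assoc] at h2
  rw [← h2]; abel

theorem E_X_smul (v : M) : E q • X q • v = q • X q • E q • v := by
  have h := toUq_eq_of_rel (Rel.E_X (q := q))
  simp only [map_mul, map_smul] at h
  have h2 := congrArg (· • v) (show E q * X q = q • (X q * E q) from h)
  simpa only [mul_smul, smul_assoc] using h2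

theorem E_Y_smul (v : M) : E q • Y q • v = X q • v + q⁻¹ • Y q • E q • v := by
  have h := toUq_eq_of_rel (Rel.E_Y (q := q))
  simp only [map_mul, map_smul, map_add] at h
  have h2 := congrArg (· • v) (show E q * Y q = X q + q⁻¹ • (Y q * E q) from h)
  simpa only [add_smul, mul_smul, smul_assoc] using h2

theorem F_X_smul (v : M) : F q • X q • v = Y q • Kinv q • v + X q • F q • v := by
  have h := toUq_eq_of_rel (Rel.F_X (q := q))
  simp only [map_mul, map_add] at h
  have h2 := congrArg (· • v) (show F q * X q = Y q * Kinv q + X q * F q from h)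
  simpa only [add_smul, mul_smul] using h2

theorem F_Y_smul (v : M) : F q • Y q • v = Y q • F q • v := by
  have h := toUq_eq_of_rel (Rel.F_Y (q := q))
  simp only [map_mul] at h
  have h2 := congrArg (· • v) (show F q * Y q = Y q * F q from h)
  simpa only [mul_smul] using h2

theorem Z_gen_smul (g : Gen) (v : M) : Z q • gen q g • v = gen q g • Z q • v := by
  have h := toUq_eq_of_rel (Rel.Z_central (q := q) g)
  simp only [map_mul] at h
  have h2 := congrArg (· • v) (show Z q * gen q g = gen q g * Z q from h)
  simpa only [mul_smul] using h2

/-- The action of a generator as a `ℂ`-linear map. -/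
def act (q : ℂ) (M : Type) [AddCommGroup M] [Module ℂ M] [Module (Uq q) M]
    [IsScalarTower ℂ (Uq q) M] (g : Gen) : M →ₗ[ℂ] M :=
  Algebra.lsmul ℂ ℂ M (gen q g)

theorem act_apply (g : Gen) (v : M) : act q M g v = gen q g • v := rfl

/-- The normally ordered form of the action of `C̃` at central charge `z`. -/
theorem casimirTilde_smul (v : M) :
    casimirTilde q • v = Z q • ((1 + q⁻¹) • (F q • E q • v + ((q - q⁻¹) ^ 2)⁻¹ • (q • K q • v
      + q⁻¹ • Kinv q • v)) + (q ^ 2 - 1)⁻¹ • Kinv q • v)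
      + X q • X q • F q • v - Y q • Y q • E q • Kinv q • v
      + X q • Y q • (q⁻¹ • F q • E q • v - q • E q • F q • v) := by
  rw [casimirTilde, casimir]
  simp only [add_smul, sub_smul, mul_smul, smul_assoc, pow_two, one_smul]

/-- Centrality is needed only against `Y` and `F`, which build a highest weight module from its
generator. The rewriting brings every word into the order Y, X, F, E, K^±1, after which the
coefficients are compared. -/
theorem casimirTilde_Y_smul (hq0 : q ≠ 0) (hq2 : q ^ 2 ≠ 1) {z : ℂ}
    (hZ : HasCentralCharge q M z) (v : M) :
    casimirTilde q • Y q • v = Y q • casimirTilde q • v := by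
  have hd := sub_ne_zero.mpr hq2
  have e : q - q⁻¹ = (q ^ 2 - 1) / q := by field_simp
  rw [casimirTilde_smul, casimirTilde_smul]
  simp only [E_F_smul, K_X_smul, K_E_smul, K_F_smul, K_Y_smul, Kinv_X_smul hq0, Kinv_E_smul hq0,
    Kinv_F_smul hq0, Kinv_Y_smul hq0, X_Y_smul, E_X_smul, E_Y_smul, F_X_smul, F_Y_smul, hZ _,
    smul_add, smul_sub, uq_smul_comm, K_Kinv_smul, Kinv_K_smul, e]
  -- The generators become linear maps, so that `match_scalars` treats only complex numbers as
  -- scalars.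
  simp only [← act_apply]
  match_scalars <;> field_simp <;> ring

theorem casimirTilde_F_smul (hq0 : q ≠ 0) (hq2 : q ^ 2 ≠ 1) {z : ℂ}
    (hZ : HasCentralCharge q M z) (v : M) :
    casimirTilde q • F q • v = F q • casimirTilde q • v := by
  have hd := sub_ne_zero.mpr hq2
  have e : q - q⁻¹ = (q ^ 2 - 1) / q := by field_simp
  rw [casimirTilde_smul, casimirTilde_smul]
  simp only [E_F_smul, K_X_smul, K_E_smul, K_F_smul, K_Y_smul, Kinv_X_smul hq0, Kinv_E_smul hq0,
    Kinv_F_smul hq0, Kinv_Y_smul hq0, X_Y_smul, E_X_smul, E_Y_smul, F_X_smul, F_Y_smul, hZ _,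
    smul_add, smul_sub, uq_smul_comm, K_Kinv_smul, Kinv_K_smul, e]
  simp only [← act_apply]
  match_scalars <;> field_simp <;> ring

end Action

/-! ### Eigenvectors, powers of q, and coincidences of central values. -/

/-- An eigenvector in the span of a set of eigenvectors lies in the span of those with the same
eigenvalue. -/
theorem mem_span_eigenvectors {M : Type*} [AddCommGroup M] [Module ℂ M] (f : Module.End ℂ M)
    {S : Set M} (hS : ∀ s ∈ S, ∃ l : ℂ, f s = l • s) {u : M} (hu : u ∈ Submodule.span ℂ S) {l : ℂ}
    (hl : f u = l • u) : u ∈ Submodule.span ℂ {s ∈ S | f s = l • s} := by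
  have hle : Submodule.span ℂ S ≤ Submodule.span ℂ {s ∈ S | f s = l • s} ⊔
      ⨆ m, ⨆ (_ : m ≠ l), f.eigenspace m := by
    refine Submodule.span_le.2 fun s hs => ?_
    obtain ⟨m, hm⟩ := hS s hs
    by_cases h : m = l
    · exact Submodule.mem_sup_left (Submodule.subset_span ⟨hs, h ▸ hm⟩)
    · exact Submodule.mem_sup_right (Submodule.mem_iSup_of_mem m (Submodule.mem_iSup_of_mem h
        (Module.End.mem_eigenspace_iff.2 hm)))
  obtain ⟨a, ha, b, hb, rfl⟩ := Submodule.mem_sup.1 (hle hu)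
  have ha' : a ∈ f.eigenspace l := by
    refine Submodule.span_le.2 (fun s hs => ?_) ha
    exact Module.End.mem_eigenspace_iff.2 hs.2
  have hb' : b ∈ f.eigenspace l := by
    have := Submodule.sub_mem _ (Module.End.mem_eigenspace_iff.2 hl) ha'
    rwa [add_sub_cancel_left] at this
  -- The remainder lies both in the `l`-eigenspace and in the sum of the others, which are
  -- independent.
  have hb0 : b = 0 := (Submodule.disjoint_def.1 (f.eigenspaces_iSupIndep l)) b hb' hb
  rwa [hb0, add_zero]

theorem pow_sum_ne_zero {q : ℂ} (hq : ∀ k : ℕ, 0 < k → q ^ k ≠ 1) (j : ℕ) :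
    ∑ i ∈ Finset.range (j + 1), q ^ i ≠ 0 := by
  intro h
  have := geom_sum_mul q (j + 1)
  rw [h, zero_mul] at this
  exact hq (j + 1) j.succ_pos (sub_eq_zero.1 this.symm)

theorem zpow_injective {q : ℂ} (hq0 : q ≠ 0) (hq : ∀ k : ℕ, 0 < k → q ^ k ≠ 1) :
    Function.Injective (fun k : ℤ => q ^ k) := by
  have key : ∀ k : ℤ, 0 < k → q ^ k ≠ 1 := fun k hk h => by
    lift k to ℕ using hk.le
    exact hq k (by exact_mod_cast hk) (by exact_mod_cast h)
  intro a b h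
  by_contra hne
  rcases lt_or_gt_of_ne hne with h' | h'
  · refine key (b - a) (by omega) ?_
    rw [zpow_sub₀ hq0]
    exact (div_eq_one_iff_eq (zpow_ne_zero _ hq0)).2 h.symm
  · refine key (a - b) (by omega) ?_
    rw [zpow_sub₀ hq0]
    exact (div_eq_one_iff_eq (zpow_ne_zero _ hq0)).2 h

theorem one_add_ne_zero {q : ℂ} (hq2 : q ^ 2 ≠ 1) : 1 + q ≠ 0 := fun h => hq2 (by
  linear_combination (q - 1) * h)

theorem centralValue_eq_iff {q : ℂ} (hq0 : q ≠ 0) (hq : ∀ k : ℕ, 0 < k → q ^ k ≠ 1) {z : ℂ}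
    (hz : z ≠ 0) (m n : ℤ) :
    centralValue q (q ^ m) z = centralValue q (q ^ n) z ↔ m = n ∨ m = -n - 3 := by
  have hq2 := hq 2 (by norm_num)
  have hd := sub_inv_ne_zero hq0 hq2
  have h1 := one_add_ne_zero hq2
  have hm := zpow_ne_zero m hq0
  have hn := zpow_ne_zero n hq0
  -- The last two factors give the two solutions m = n and m + n = -3; the rest is a nonzero
  -- constant.
  have key : centralValue q (q ^ m) z - centralValue q (q ^ n) z =
      z / (q - q⁻¹) ^ 2 * (1 + q) * q⁻¹ ^ 2 * (q ^ m - q ^ n) * (q ^ 3 - (q ^ m)⁻¹ * (q ^ n)⁻¹) := by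
    simp only [centralValue]
    field_simp
    ring
  rw [← sub_eq_zero, key]
  have e : q ^ 3 - (q ^ m)⁻¹ * (q ^ n)⁻¹ = q ^ (3 : ℤ) - q ^ (-m - n) := by
    rw [zpow_sub₀ hq0, zpow_neg, div_eq_mul_inv]; norm_cast
  rw [e, mul_eq_zero, mul_eq_zero, sub_eq_zero, sub_eq_zero, (zpow_injective hq0 hq).eq_iff,
    (zpow_injective hq0 hq).eq_iff]
  have : z / (q - q⁻¹) ^ 2 * (1 + q) * q⁻¹ ^ 2 ≠ 0 := by positivity
  simp only [this, false_or]
  omega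

/-! ### The rank one structure on the kernel of X. -/

/-- The lowering operator `zF - (1+q)⁻¹ Y²K⁻¹`, which preserves the kernel of `X` at central
charge `z`. -/
def lowering (q z : ℂ) : Uq q := z • F q - (1 + q)⁻¹ • (Y q * Y q * Kinv q)

section Action

set_option linter.unusedSectionVars false
set_option linter.unusedSimpArgs false

variable {q : ℂ} {M : Type} [AddCommGroup M] [Module ℂ M] [Module (Uq q) M]
  [IsScalarTower ℂ (Uq q) M]

theorem lowering_smul (z : ℂ) (v : M) :
    lowering q z • v = z • F q • v - (1 + q)⁻¹ • Y q • Y q • Kinv q • v := by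
  simp only [lowering, sub_smul, smul_assoc, mul_smul]

theorem Kinv_smul_of_K_smul {l : ℂ} (hl : l ≠ 0) {v : M} (h : K q • v = l • v) :
    Kinv q • v = l⁻¹ • v := by
  have h2 := Kinv_K_smul (q := q) v
  rw [h, uq_smul_comm] at h2
  rw [← h2, inv_smul_smul₀ hl, h2]

theorem K_smul_X {l : ℂ} {v : M} (h : K q • v = l • v) :
    K q • X q • v = (q * l) • X q • v := by
  rw [K_X_smul, h, uq_smul_comm, smul_smul]

theorem K_smul_E {l : ℂ} {v : M} (h : K q • v = l • v) :
    K q • E q • v = (q ^ 2 * l) • E q • v := by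
  rw [K_E_smul, h, uq_smul_comm, smul_smul]

theorem K_smul_Y {l : ℂ} {v : M} (h : K q • v = l • v) :
    K q • Y q • v = (q⁻¹ * l) • Y q • v := by
  rw [K_Y_smul, h, uq_smul_comm, smul_smul]

theorem K_smul_lowering (hq0 : q ≠ 0) (z : ℂ) {l : ℂ} (hl : l ≠ 0) {v : M}
    (h : K q • v = l • v) :
    K q • lowering q z • v = ((q ^ 2)⁻¹ * l) • lowering q z • v := by
  simp only [lowering_smul, smul_sub, uq_smul_comm, K_F_smul, K_Y_smul, h,
    Kinv_smul_of_K_smul hl h]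
  simp only [← act_apply]
  match_scalars <;> field_simp

theorem X_smul_E (hq0 : q ≠ 0) {v : M} (h : X q • v = 0) : X q • E q • v = 0 := by
  have := E_X_smul (q := q) v
  rw [h, smul_zero] at this
  exact (smul_eq_zero_iff_right hq0).1 this.symm

theorem X_smul_F {v : M} (h : X q • v = 0) : X q • F q • v = - (Y q • Kinv q • v) := by
  have := F_X_smul (q := q) v
  rw [h, smul_zero] at this
  exact (neg_eq_of_add_eq_zero_right this.symm).symm

variable {z : ℂ} (hZ : HasCentralCharge q M z)
include hZ

/-- On ker X one has XF = -YK⁻¹ and XY² = -z(1 + q)Y; the coefficient (1 + q)⁻¹ in `lowering` is the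
one that makes the two terms cancel. -/
theorem X_smul_lowering (hq2 : q ^ 2 ≠ 1) {l : ℂ} (hl : l ≠ 0) {v : M}
    (h : X q • v = 0) (hK : K q • v = l • v) : X q • lowering q z • v = 0 := by
  have h1 := one_add_ne_zero hq2
  simp only [lowering_smul, smul_sub, uq_smul_comm, X_smul_F h, X_Y_smul, hZ _, h,
    Kinv_smul_of_K_smul hl hK, smul_zero, smul_neg]
  simp only [← act_apply]
  match_scalars
  field_simp
  ring

/-- The commutator of `E` and F' is a scalar on each weight space of ker X, as for sl₂; this makes
`E` send F'^(i+1) v to a multiple of F'^i v. -/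
theorem E_smul_lowering (hq0 : q ≠ 0) (hq2 : q ^ 2 ≠ 1) {l : ℂ} (hl : l ≠ 0) {v : M}
    (h : X q • v = 0) (hK : K q • v = l • v) :
    E q • lowering q z • v = lowering q z • E q • v +
      (z * ((q - q⁻¹)⁻¹ * (l - l⁻¹) + (1 + q)⁻¹ * l⁻¹)) • v := by
  have h1 := one_add_ne_zero hq2
  have hd := sub_ne_zero.mpr hq2
  have e : q - q⁻¹ = (q ^ 2 - 1) / q := by field_simp
  simp only [lowering_smul, smul_sub, uq_smul_comm, E_F_smul, E_Y_smul, X_Y_smul, hZ _, h,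
    Kinv_smul_of_K_smul hl hK, Kinv_E_smul hq0, smul_zero, smul_neg, smul_add, hK, e]
  simp only [← act_apply]
  match_scalars <;> field_simp
  ring

/-- Here C̃ plays the part of the sl₂ Casimir for `E` and F'. A vector of ker X whose weight has a
central value other than the eigenvalue of C̃ can thus be recovered from F'E applied to it. -/
theorem casimirTilde_smul_of_X_smul_eq_zero (hq0 : q ≠ 0) (hq2 : q ^ 2 ≠ 1) {l : ℂ} (hl : l ≠ 0)
    {v : M} (h : X q • v = 0) (hK : K q • v = l • v) :
    casimirTilde q • v = (1 + q) • lowering q z • E q • v + centralValue q l z • v := by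
  have h1 := one_add_ne_zero hq2
  have hd := sub_ne_zero.mpr hq2
  have e : q - q⁻¹ = (q ^ 2 - 1) / q := by field_simp
  have hE := X_smul_E hq0 h
  rw [casimirTilde_smul, centralValue]
  simp only [lowering_smul, smul_sub, uq_smul_comm, E_F_smul, X_Y_smul, hZ _, h, X_smul_F h,
    X_smul_F hE, hE, Kinv_smul_of_K_smul hl hK, Kinv_Y_smul hq0, Kinv_E_smul hq0, smul_zero,
    smul_neg, smul_add, hK, e]
  simp only [← act_apply]
  match_scalars <;> field_simp <;> ring

theorem X_smul_Y_pow_succ {v : M} (h : X q • v = 0) (j : ℕ) :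
    X q • Y q ^ (j + 1) • v = (-z * ∑ i ∈ Finset.range (j + 1), q ^ i) • Y q ^ j • v := by
  induction j with
  | zero => simp [X_Y_smul, h, hZ _]
  | succ j ih =>
    rw [pow_succ' (Y q) (j + 1), mul_smul, X_Y_smul, ih, hZ, uq_smul_comm, ← mul_smul (Y q),
      ← pow_succ', smul_smul, ← sub_smul]
    congr 1
    rw [geom_sum_succ (n := j + 1)]
    ring

/-- Only spans of monomials matter later, so the scalar `a` is left unspecified; the recursion comes
from EY = X + q⁻¹YE. -/
theorem E_smul_Y_pow {v : M} (h : X q • v = 0) (j : ℕ) :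
    ∃ a : ℂ, E q • Y q ^ (j + 2) • v =
      a • Y q ^ j • v + (q⁻¹ ^ (j + 2)) • Y q ^ (j + 2) • E q • v := by
  induction j with
  | zero =>
    refine ⟨-z, ?_⟩
    simp only [zero_add, pow_two, mul_smul, E_Y_smul, X_Y_smul, h, hZ _, smul_zero, zero_sub,
      pow_zero, one_smul, uq_smul_comm, neg_smul, zero_add]
  | succ j ih =>
    obtain ⟨a, ha⟩ := ih
    refine ⟨-z * ∑ i ∈ Finset.range (j + 2), q ^ i + q⁻¹ * a, ?_⟩
    rw [pow_succ' (Y q) (j + 2), mul_smul, mul_smul, E_Y_smul, X_smul_Y_pow_succ hZ h (j + 1), ha,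
      smul_add, uq_smul_comm, uq_smul_comm, smul_add, add_smul, smul_smul q⁻¹ a, smul_smul q⁻¹ (q⁻¹ ^ (j + 2)),
      ← mul_smul (Y q), ← pow_succ' (Y q) j, ← pow_succ' q⁻¹ (j + 2)]
    exact (add_assoc _ _ _).symm

/-- The scalar is a product of factors -z(1 + q + ⋯ + q^i), nonzero because z ≠ 0 and q is not a
root of unity. It does not depend on `v`. -/
theorem X_pow_smul_Y_pow (hz : z ≠ 0) (hq : ∀ k : ℕ, 0 < k → q ^ k ≠ 1) (j : ℕ) :
    ∃ a : ℂ, a ≠ 0 ∧ ∀ v : M, X q • v = 0 → X q ^ j • Y q ^ j • v = a • v := by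
  induction j with
  | zero => exact ⟨1, one_ne_zero, fun v _ => by simp⟩
  | succ j ih =>
    obtain ⟨a, ha, h⟩ := ih
    refine ⟨_, mul_ne_zero (mul_ne_zero (neg_ne_zero.2 hz) (pow_sum_ne_zero hq j)) ha,
      fun v hv => ?_⟩
    rw [pow_succ (X q), mul_smul, X_smul_Y_pow_succ hZ hv, uq_smul_comm, h v hv, smul_smul]

end Action

/-! ### An explicit representation on functions on ℤ × ℤ. -/

section Model

/-- The action of the generators on functions on `ℤ × ℤ`; the function supported at `(j, i)`
models the vector `Y^j F'^i v` for a highest weight vector `v` of weight `l` and central charge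
`z`, where `F'` is the lowering operator. -/
def modelAct (q l z : ℂ) : Gen → (ℤ → ℤ → ℂ) →ₗ[ℂ] (ℤ → ℤ → ℂ)
  | .X =>
    { toFun := fun f j i => -z * ((q ^ (j + 1) - 1) / (q - 1)) * f (j + 1) i
      map_add' := fun f g => by ext; simp; ring
      map_smul' := fun a f => by ext; simp; ring }
  | .Y =>
    { toFun := fun f j i => f (j - 1) i
      map_add' := fun f g => rfl
      map_smul' := fun a f => rfl }
  | .Z =>
    { toFun := fun f j i => z * f j i
      map_add' := fun f g => by ext; simp; ring
      map_smul' := fun a f => by ext; simp; ring }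
  | .K =>
    { toFun := fun f j i => l * (q ^ j)⁻¹ * ((q ^ i)⁻¹) ^ 2 * f j i
      map_add' := fun f g => by ext; simp; ring
      map_smul' := fun a f => by ext; simp; ring }
  | .Kinv =>
    { toFun := fun f j i => l⁻¹ * q ^ j * (q ^ i) ^ 2 * f j i
      map_add' := fun f g => by ext; simp; ring
      map_smul' := fun a f => by ext; simp; ring }
  | .F =>
    { toFun := fun f j i => z⁻¹ * (f j (i - 1) + (1 + q)⁻¹ * l⁻¹ * (q ^ i) ^ 2 * f (j - 2) i)
      map_add' := fun f g => by ext; simp; ring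
      map_smul' := fun a f => by ext; simp; ring }
  | .E =>
    -- The coefficients are the summed recursions for `E` on Y^j and on F'^i. The first vanishes at
    -- j = -2 and j = -1, the second at i = -1, so nothing leaks from ℕ × ℕ to negative indices.
    { toFun := fun f j i =>
        -z * (q / ((q - 1) * (q ^ 2 - 1)) * (q ^ (j + 2) - (q ^ (j + 2))⁻¹)
          - q / (q - 1) ^ 2 * (1 - (q ^ (j + 2))⁻¹)) * f (j + 2) i
        + (q ^ j)⁻¹ * z * (l / (q - q⁻¹) / ((q ^ 2)⁻¹ - 1) * (((q ^ (i + 1))⁻¹) ^ 2 - 1)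
          + ((1 + q)⁻¹ - (q - q⁻¹)⁻¹) * l⁻¹ / (q ^ 2 - 1) * ((q ^ (i + 1)) ^ 2 - 1)) * f j (i + 1)
      map_add' := fun f g => by ext; simp; ring
      map_smul' := fun a f => by ext; simp; ring }

/-- Because all of ℤ × ℤ is used, there are no boundary cases: every relation becomes a rational
identity in q, q^j and q^i. -/
theorem modelAct_rel {q l z : ℂ} (hq0 : q ≠ 0) (hq2 : q ^ 2 ≠ 1) (hl : l ≠ 0) (hz : z ≠ 0)
    ⦃a b : FreeAlgebra ℂ Gen⦄ (h : Rel q a b) :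
    FreeAlgebra.lift ℂ (A := Module.End ℂ (ℤ → ℤ → ℂ)) (modelAct q l z) a =
      FreeAlgebra.lift ℂ (A := Module.End ℂ (ℤ → ℤ → ℂ)) (modelAct q l z) b := by
  have h1 := one_add_ne_zero hq2
  have hd := sub_ne_zero.mpr hq2
  have h3 : q - 1 ≠ 0 := fun h => hq2 (by linear_combination (q + 1) * h)
  have e : q - q⁻¹ = (q ^ 2 - 1) / q := by field_simp
  have e' : (q ^ 2)⁻¹ - 1 = -(q ^ 2 - 1) / q ^ 2 := by field_simp; ring
  cases h with
  | Z_central g =>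
    simp only [map_mul, FreeAlgebra.lift_ι_apply]
    ext f j i
    cases g <;> simp [modelAct] <;> ring
  | _ =>
    simp only [map_mul, map_add, map_sub, map_smul, map_one, FreeAlgebra.lift_ι_apply]
    ext f j i
    have hj := zpow_ne_zero j hq0
    have hi := zpow_ne_zero i hq0
    have a1 : j - 1 + 2 = j + 1 := by ring
    have a2 : j + 1 + 2 = j + 2 + 1 := by ring
    have a3 : j - 2 + 1 = j - 1 := by ring
    have a4 : j + 1 - 2 = j - 1 := by ring
    have a5 : j + 2 - 1 = j + 1 := by ring
    have a6 : j - 1 - 2 = j - 2 - 1 := by ring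
    simp [modelAct, zpow_add₀ hq0, zpow_sub₀ hq0, e, e', a1, a2, a3, a4, a5, a6]
    try generalize q ^ j = s at *
    try generalize q ^ i = t at *
    try field_simp
    try ring

end Model

/-! ### Generation of the algebra, and stability of subspaces. -/

theorem adjoin_range_gen (q : ℂ) : Algebra.adjoin ℂ (Set.range (gen q)) = ⊤ := by
  have h := congrArg (Subalgebra.map (toUq q)) (FreeAlgebra.adjoin_range_ι ℂ Gen)
  rw [AlgHom.map_adjoin, Algebra.map_top, (AlgHom.range_eq_top _).2 (toUq_surjective q),
    ← Set.range_comp] at h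
  exact h

theorem Z_mul_comm {q : ℂ} (a : Uq q) : Z q * a = a * Z q := by
  have ha : a ∈ Algebra.adjoin ℂ (Set.range (gen q)) := by rw [adjoin_range_gen]; trivial
  induction ha using Algebra.adjoin_induction with
  | mem x hx =>
    obtain ⟨g, rfl⟩ := hx
    simpa using Z_gen_smul (q := q) g (1 : Uq q)
  | algebraMap r => exact (Algebra.commutes r _).symm
  | add x y _ _ hx hy => rw [mul_add, add_mul, hx, hy]
  | mul x y _ _ hx hy => rw [← mul_assoc, hx, mul_assoc, hy, mul_assoc]

section Stability

variable {q : ℂ} {M : Type} [AddCommGroup M] [Module ℂ M] [Module (Uq q) M]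
  [IsScalarTower ℂ (Uq q) M]

theorem adjoin_smul_mem {s : Set (Uq q)} (T : Submodule ℂ M)
    (hT : ∀ g ∈ s, ∀ x ∈ T, g • x ∈ T) {a : Uq q} (ha : a ∈ Algebra.adjoin ℂ s) :
    ∀ x ∈ T, a • x ∈ T := by
  induction ha using Algebra.adjoin_induction with
  | mem x hx => exact hT x hx
  | algebraMap r => exact fun x hx => by rw [algebraMap_smul]; exact T.smul_mem r hx
  | add a b _ _ ha hb => exact fun x hx => by rw [add_smul]; exact T.add_mem (ha x hx) (hb x hx)
  | mul a b _ _ ha hb => exact fun x hx => by rw [mul_smul]; exact ha _ (hb x hx)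

theorem smul_mem_of_gen_smul_mem (T : Submodule ℂ M)
    (hT : ∀ g, ∀ x ∈ T, gen q g • x ∈ T) (a : Uq q) {x : M} (hx : x ∈ T) : a • x ∈ T :=
  adjoin_smul_mem (s := Set.range (gen q)) T (by rintro _ ⟨g, rfl⟩; exact hT g)
    (by rw [adjoin_range_gen]; trivial) x hx

theorem gen_smul_mem_span {S : Set M} {g : Uq q} {T : Submodule ℂ M} (h : ∀ s ∈ S, g • s ∈ T)
    {x : M} (hx : x ∈ Submodule.span ℂ S) : g • x ∈ T :=
  (Submodule.span_le (p := T.comap (Algebra.lsmul ℂ ℂ M g))).2 h hx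

theorem mem_weightSpace {l : ℂ} {v : M} : v ∈ weightSpace q M l ↔ K q • v = l • v :=
  Module.End.mem_eigenspace_iff

end Stability

/-! ### Highest weight modules and their monomial spanning vectors. -/

section HighestWeight

/-- The space of highest weight vectors of weight `l`. -/
def highestWeightSpace (q : ℂ) (M : Type) [AddCommGroup M] [Module ℂ M] [Module (Uq q) M]
    [IsScalarTower ℂ (Uq q) M] (l : ℂ) : Submodule ℂ M :=
  LinearMap.ker (Algebra.lsmul ℂ ℂ M (E q)) ⊓ LinearMap.ker (Algebra.lsmul ℂ ℂ M (X q)) ⊓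
    weightSpace q M l

variable {q : ℂ} {M : Type} [AddCommGroup M] [Module ℂ M] [Module (Uq q) M]
  [IsScalarTower ℂ (Uq q) M]

theorem mem_highestWeightSpace {l : ℂ} {v : M} :
    v ∈ highestWeightSpace q M l ↔ E q • v = 0 ∧ X q • v = 0 ∧ K q • v = l • v := by
  simp [highestWeightSpace, mem_weightSpace, and_assoc]

theorem map_mem_highestWeightSpace {N : Type} [AddCommGroup N] [Module ℂ N] [Module (Uq q) N]
    [IsScalarTower ℂ (Uq q) N] (f : M →ₗ[Uq q] N) {l : ℂ} {v : M}
    (hv : v ∈ highestWeightSpace q M l) : f v ∈ highestWeightSpace q N l := by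
  rw [mem_highestWeightSpace] at *
  refine ⟨by rw [← map_smul, hv.1, map_zero], by rw [← map_smul, hv.2.1, map_zero], ?_⟩
  rw [← map_smul, hv.2.2, ← algebraMap_smul (Uq q), map_smul, algebraMap_smul]

variable {z l : ℂ}

variable (q z) in
/-- The vector `Y^j F'^i v`, with `F'` the lowering operator. -/
def monomialVector (v : M) (j i : ℕ) : M := Y q ^ j • lowering q z ^ i • v

theorem lowering_pow_smul (hZ : HasCentralCharge q M z) (hq0 : q ≠ 0) (hq2 : q ^ 2 ≠ 1)
    (hl : l ≠ 0) {v : M} (hv : v ∈ highestWeightSpace q M l) (i : ℕ) :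
    X q • lowering q z ^ i • v = 0 ∧
    K q • lowering q z ^ i • v = (l * (q ^ 2)⁻¹ ^ i) • lowering q z ^ i • v := by
  rw [mem_highestWeightSpace] at hv
  induction i with
  | zero => simpa using hv.2
  | succ i ih =>
    have hn : l * (q ^ 2)⁻¹ ^ i ≠ 0 := by positivity
    rw [pow_succ', mul_smul]
    refine ⟨X_smul_lowering hZ hq2 hn ih.1 ih.2, ?_⟩
    rw [K_smul_lowering hq0 z hn ih.2]
    congr 1
    ring

theorem E_smul_lowering_pow (hZ : HasCentralCharge q M z) (hq0 : q ≠ 0) (hq2 : q ^ 2 ≠ 1)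
    (hl : l ≠ 0) {v : M} (hv : v ∈ highestWeightSpace q M l) (i : ℕ) :
    ∃ a : ℂ, E q • lowering q z ^ (i + 1) • v = a • lowering q z ^ i • v := by
  induction i with
  | zero =>
    have h := mem_highestWeightSpace.1 hv
    have h2 := E_smul_lowering hZ hq0 hq2 hl h.2.1 h.2.2
    rw [h.1, smul_zero, zero_add] at h2
    simp only [zero_add, pow_one, pow_zero, one_smul (Uq q)]
    exact ⟨_, h2⟩
  | succ i ih =>
    obtain ⟨a, ha⟩ := ih
    obtain ⟨h1, h2⟩ := lowering_pow_smul hZ hq0 hq2 hl hv (i + 1)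
    have hn : l * (q ^ 2)⁻¹ ^ (i + 1) ≠ 0 := by positivity
    have h3 := E_smul_lowering hZ hq0 hq2 hn h1 h2
    rw [ha, uq_smul_comm, ← mul_smul (lowering q z), ← mul_smul (lowering q z), ← pow_succ',
      ← pow_succ', ← add_smul] at h3
    exact ⟨_, h3⟩

theorem K_smul_monomialVector (hZ : HasCentralCharge q M z) (hq0 : q ≠ 0) (hq2 : q ^ 2 ≠ 1)
    (hl : l ≠ 0) {v : M} (hv : v ∈ highestWeightSpace q M l) (j i : ℕ) :
    K q • monomialVector q z v j i = (l * q⁻¹ ^ (j + 2 * i)) • monomialVector q z v j i := by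
  induction j with
  | zero =>
    simp only [monomialVector, pow_zero, one_smul, (lowering_pow_smul hZ hq0 hq2 hl hv i).2,
      zero_add, pow_mul, inv_pow]
  | succ j ih =>
    have e : monomialVector q z v (j + 1) i = Y q • monomialVector q z v j i := by
      rw [monomialVector, pow_succ', mul_smul]; rfl
    rw [e, K_smul_Y ih]
    congr 1
    ring

/-- `E` never increases the depth j + 2i below `v`, so `T` need only contain the monomials up to
that depth. This form serves both the full span and the finite-dimensional truncations used for
local finiteness; likewise for `X` below. -/
theorem E_smul_monomialVector (hZ : HasCentralCharge q M z) (hq0 : q ≠ 0) (hq2 : q ^ 2 ≠ 1)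
    (hl : l ≠ 0) {v : M} (hv : v ∈ highestWeightSpace q M l) (T : Submodule ℂ M) (j i : ℕ)
    (h : ∀ j' i', j' + 2 * i' ≤ j + 2 * i → monomialVector q z v j' i' ∈ T) :
    E q • monomialVector q z v j i ∈ T := by
  have hX := (lowering_pow_smul hZ hq0 hq2 hl hv i).1
  have h0 : ∀ c : ℂ, c • Y q ^ j • E q • lowering q z ^ i • v ∈ T := by
    intro c
    refine T.smul_mem c ?_
    rcases i with _ | i
    · rw [pow_zero, one_smul, (mem_highestWeightSpace.1 hv).1, smul_zero]; exact T.zero_mem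
    · obtain ⟨a, ha⟩ := E_smul_lowering_pow hZ hq0 hq2 hl hv i
      rw [ha, uq_smul_comm]
      exact T.smul_mem a (h j i (by omega))
  rcases j with _ | _ | j
  · simpa [monomialVector] using h0 1
  · have := h0 q⁻¹
    simpa [monomialVector, E_Y_smul, hX] using this
  · obtain ⟨a, ha⟩ := E_smul_Y_pow hZ hX j
    rw [monomialVector, ha]
    exact T.add_mem (T.smul_mem a (h j i (by omega))) (h0 _)

theorem X_smul_monomialVector (hZ : HasCentralCharge q M z) (hq0 : q ≠ 0) (hq2 : q ^ 2 ≠ 1)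
    (hl : l ≠ 0) {v : M} (hv : v ∈ highestWeightSpace q M l) (T : Submodule ℂ M) (j i : ℕ)
    (h : ∀ j' i', j' + 2 * i' ≤ j + 2 * i → monomialVector q z v j' i' ∈ T) :
    X q • monomialVector q z v j i ∈ T := by
  have hX := (lowering_pow_smul hZ hq0 hq2 hl hv i).1
  rcases j with _ | j
  · rw [monomialVector, pow_zero, one_smul, hX]; exact T.zero_mem
  · rw [monomialVector, X_smul_Y_pow_succ hZ hX]
    exact T.smul_mem _ (h j i (by omega))

/-- `F` commutes with `Y`, and z ≠ 0 allows solving the definition of F' for `F`. -/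
theorem F_smul_monomialVector (hZ : HasCentralCharge q M z) (hq0 : q ≠ 0) (hq2 : q ^ 2 ≠ 1)
    (hz : z ≠ 0) (hl : l ≠ 0) {v : M} (hv : v ∈ highestWeightSpace q M l) (j i : ℕ) :
    ∃ a b : ℂ, F q • monomialVector q z v j i =
      a • monomialVector q z v j (i + 1) + b • monomialVector q z v (j + 2) i := by
  have hF : ∀ w : M, F q • Y q ^ j • w = Y q ^ j • F q • w := by
    intro w
    induction j with
    | zero => simp
    | succ j ih => rw [pow_succ', mul_smul, F_Y_smul, ih, mul_smul]
  have hn : l * (q ^ 2)⁻¹ ^ i ≠ 0 := by positivity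
  have hF2 : F q • lowering q z ^ i • v = z⁻¹ • lowering q z ^ (i + 1) • v +
      (z⁻¹ * ((1 + q)⁻¹ * (l * (q ^ 2)⁻¹ ^ i)⁻¹)) • Y q • Y q • lowering q z ^ i • v := by
    rw [pow_succ', mul_smul]
    generalize hw : lowering q z ^ i • v = w
    rw [lowering_smul, Kinv_smul_of_K_smul hn (hw ▸ (lowering_pow_smul hZ hq0 hq2 hl hv i).2),
      uq_smul_comm, uq_smul_comm]
    simp only [← act_apply]
    match_scalars <;> field_simp
    ring
  have h := hF (lowering q z ^ i • v)
  rw [hF2, smul_add, uq_smul_comm, uq_smul_comm, ← mul_smul (Y q) (Y q),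
    ← mul_smul _ (Y q * Y q), ← pow_two, ← pow_add] at h
  exact ⟨_, _, h⟩

/-- A module generated by a highest weight vector `v` is spanned by the vectors `Y^j F'^i v`. -/
theorem span_monomialVector (hZ : HasCentralCharge q M z) (hq0 : q ≠ 0) (hq2 : q ^ 2 ≠ 1)
    (hz : z ≠ 0) (hl : l ≠ 0) {v : M} (hv : v ∈ highestWeightSpace q M l)
    (hgen : Submodule.span (Uq q) {v} = ⊤) :
    Submodule.span ℂ (Set.range fun p : ℕ × ℕ => monomialVector q z v p.1 p.2) = ⊤ := by
  set T := Submodule.span ℂ (Set.range fun p : ℕ × ℕ => monomialVector q z v p.1 p.2) with hT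
  have mem : ∀ j i, monomialVector q z v j i ∈ T := fun j i => Submodule.subset_span ⟨(j, i), rfl⟩
  have hvT : v ∈ T := by simpa [monomialVector] using mem 0 0
  rw [eq_top_iff]
  intro x _
  have hx : x ∈ Submodule.span (Uq q) {v} := by rw [hgen]; trivial
  obtain ⟨a, rfl⟩ := Submodule.mem_span_singleton.1 hx
  refine smul_mem_of_gen_smul_mem T (fun g y hy => ?_) a hvT
  refine gen_smul_mem_span ?_ hy
  rintro _ ⟨⟨j, i⟩, rfl⟩
  have hK := K_smul_monomialVector hZ hq0 hq2 hl hv j i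
  cases g with
  | E => exact E_smul_monomialVector hZ hq0 hq2 hl hv T j i fun j' i' _ => mem j' i'
  | X => exact X_smul_monomialVector hZ hq0 hq2 hl hv T j i fun j' i' _ => mem j' i'
  | F =>
    obtain ⟨a, b, h⟩ := F_smul_monomialVector hZ hq0 hq2 hz hl hv j i
    exact h ▸ T.add_mem (T.smul_mem a (mem _ _)) (T.smul_mem b (mem _ _))
  | K => exact hK ▸ T.smul_mem _ (mem j i)
  | Kinv => exact Kinv_smul_of_K_smul (by positivity) hK ▸ T.smul_mem _ (mem j i)
  | Y =>
    have := mem (j + 1) i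
    rwa [monomialVector, pow_succ', mul_smul] at this
  | Z => exact hZ (monomialVector q z v j i) ▸ T.smul_mem _ (mem j i)

/-- `C̃` acts by a scalar on a highest weight module. -/
theorem casimirTilde_smul_of_generated (hZ : HasCentralCharge q M z) (hq0 : q ≠ 0)
    (hq2 : q ^ 2 ≠ 1) (hz : z ≠ 0) (hl : l ≠ 0) {v : M} (hv : v ∈ highestWeightSpace q M l)
    (hgen : Submodule.span (Uq q) {v} = ⊤) (u : M) :
    casimirTilde q • u = centralValue q l z • u := by
  have h1 : ∀ i, casimirTilde q • lowering q z ^ i • v =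
      centralValue q l z • lowering q z ^ i • v := by
    intro i
    induction i with
    | zero =>
      obtain ⟨hE, hX, hK⟩ := mem_highestWeightSpace.1 hv
      rw [pow_zero, one_smul]
      exact casimirTilde_smul_of_highest hq0 hq2 hl hE hX hK (hZ v)
    | succ i ih =>
      have hn : l * (q ^ 2)⁻¹ ^ i ≠ 0 := by positivity
      -- On a weight vector F' is a combination of `F` and Y², both of which commute with C̃.
      rw [pow_succ', mul_smul, lowering_smul,
        Kinv_smul_of_K_smul hn (lowering_pow_smul hZ hq0 hq2 hl hv i).2]
      simp only [smul_sub, uq_smul_comm, casimirTilde_F_smul hq0 hq2 hZ,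
        casimirTilde_Y_smul hq0 hq2 hZ, ih]
      simp only [smul_comm (centralValue q l z)]
  have hu : u ∈ Submodule.span ℂ (Set.range fun p : ℕ × ℕ => monomialVector q z v p.1 p.2) := by
    rw [span_monomialVector hZ hq0 hq2 hz hl hv hgen]; trivial
  rw [← sub_eq_zero, ← algebraMap_smul (Uq q), ← sub_smul]
  refine gen_smul_mem_span (T := ⊥) ?_ hu
  rintro _ ⟨⟨j, i⟩, rfl⟩
  rw [Submodule.mem_bot, sub_smul, algebraMap_smul, sub_eq_zero]
  induction j with
  | zero => simpa [monomialVector] using h1 i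
  | succ j ih =>
    simp only [monomialVector] at ih ⊢
    rw [pow_succ', mul_smul, casimirTilde_Y_smul hq0 hq2 hZ, ih, uq_smul_comm]

/-- The vectors killed by `X` in a highest weight module of weight `q ^ n` have weights
`q ^ (n - 2i)`. -/
theorem exists_weight_of_X_smul_eq_zero (hZ : HasCentralCharge q M z) (hq0 : q ≠ 0)
    (hq : ∀ k : ℕ, 0 < k → q ^ k ≠ 1) (hz : z ≠ 0) {n m : ℤ} {v : M}
    (hv : v ∈ highestWeightSpace q M (q ^ n)) (hgen : Submodule.span (Uq q) {v} = ⊤)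
    {u : M} (hu0 : u ≠ 0) (hX : X q • u = 0) (hK : K q • u = q ^ m • u) :
    ∃ i : ℕ, m = n - 2 * i := by
  have hq2 := hq 2 (by norm_num)
  have hl := zpow_ne_zero n hq0
  set S := Set.range fun p : ℕ × ℕ => monomialVector q z v p.1 p.2 with hS
  have hu : u ∈ Submodule.span ℂ S := by
    rw [span_monomialVector hZ hq0 hq2 hz hl hv hgen]; trivial
  -- YX is diagonal on monomials and its eigenvalue is nonzero unless j = 0. A vector killed by `X`
  -- is therefore in the span of the F'^i v; cutting further by the eigenvalue of `K` leaves the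
  -- weights q^(n - 2i).
  have key : ∀ j i, (Y q * X q) • monomialVector q z v (j + 1) i =
      (-z * ∑ k ∈ Finset.range (j + 1), q ^ k) • monomialVector q z v (j + 1) i := by
    intro j i
    rw [monomialVector, mul_smul,
      X_smul_Y_pow_succ hZ (lowering_pow_smul hZ hq0 hq2 hl hv i).1 j, uq_smul_comm,
      ← mul_smul (Y q), ← pow_succ']
  have hu1 := mem_span_eigenvectors (Algebra.lsmul ℂ ℂ M (Y q * X q)) (S := S) (l := 0) ?_ hu ?_
  rotate_left
  · rintro _ ⟨⟨_ | j, i⟩, rfl⟩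
    · refine ⟨0, ?_⟩
      simp [monomialVector, (lowering_pow_smul hZ hq0 hq2 hl hv i).1]
    · exact ⟨_, key j i⟩
  · simp [hX]
  have hu2 := mem_span_eigenvectors (Algebra.lsmul ℂ ℂ M (K q)) (l := q ^ m) ?_ hu1 hK
  rotate_left
  · rintro _ ⟨⟨⟨j, i⟩, rfl⟩, -⟩
    exact ⟨_, K_smul_monomialVector hZ hq0 hq2 hl hv j i⟩
  obtain ⟨s, ⟨⟨⟨⟨j, i⟩, rfl⟩, h0⟩, hs⟩, hne⟩ : ∃ s ∈ {s ∈ {s ∈ S | Algebra.lsmul ℂ ℂ M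
      (Y q * X q) s = (0 : ℂ) • s} | Algebra.lsmul ℂ ℂ M (K q) s = q ^ m • s}, s ≠ 0 := by
    by_contra! hcon
    exact hu0 ((Submodule.mem_bot ℂ).1 ((Submodule.span_le (p := ⊥)).2 hcon hu2))
  rcases j with _ | j
  · have hs' := (K_smul_monomialVector hZ hq0 hq2 hl hv 0 i).symm.trans hs
    refine ⟨i, zpow_injective hq0 hq ?_⟩
    have := smul_left_injective ℂ hne hs'
    simp only at this ⊢
    rw [← this, zpow_sub₀ hq0, zero_add, inv_pow, div_eq_mul_inv]
    norm_cast
  · have := (key j i).symm.trans h0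
    have := smul_left_injective ℂ hne this
    exact absurd this (mul_ne_zero (neg_ne_zero.2 hz) (pow_sum_ne_zero hq j))

/-- The highest weight space of a highest weight module is one-dimensional. -/
theorem mem_span_of_K_smul (hZ : HasCentralCharge q M z) (hq0 : q ≠ 0)
    (hq : ∀ k : ℕ, 0 < k → q ^ k ≠ 1) (hz : z ≠ 0) (hl : l ≠ 0) {v : M}
    (hv : v ∈ highestWeightSpace q M l) (hgen : Submodule.span (Uq q) {v} = ⊤)
    {u : M} (hK : K q • u = l • u) : u ∈ Submodule.span ℂ {v} := by
  have hq2 := hq 2 (by norm_num)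
  have hu : u ∈ Submodule.span ℂ (Set.range fun p : ℕ × ℕ => monomialVector q z v p.1 p.2) := by
    rw [span_monomialVector hZ hq0 hq2 hz hl hv hgen]; trivial
  have hu2 := mem_span_eigenvectors (Algebra.lsmul ℂ ℂ M (K q)) (l := l) ?_ hu hK
  · refine Submodule.span_le.2 ?_ hu2
    rintro _ ⟨⟨⟨j, i⟩, rfl⟩, hs⟩
    have hs' := (K_smul_monomialVector hZ hq0 hq2 hl hv j i).symm.trans hs
    by_cases h0 : monomialVector q z v j i = 0
    · simp [h0]
    have h1 := smul_left_injective ℂ h0 hs'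
    have h2 : q ^ (j + 2 * i) = 1 := by
      simpa [hl] using h1
    have h3 : j + 2 * i = 0 := by
      by_contra hne
      exact hq _ (Nat.pos_of_ne_zero hne) h2
    obtain ⟨rfl, rfl⟩ : j = 0 ∧ i = 0 := by omega
    simp [monomialVector]
  · rintro _ ⟨⟨j, i⟩, rfl⟩
    exact ⟨_, K_smul_monomialVector hZ hq0 hq2 hl hv j i⟩

end HighestWeight

/-! ### Weights of highest weight modules, and weight vectors in submodules. -/

section Weights

variable {q : ℂ} {M : Type} [AddCommGroup M] [Module ℂ M] [Module (Uq q) M]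
  [IsScalarTower ℂ (Uq q) M] {z : ℂ}

theorem exists_weight_of_ne_zero (hZ : HasCentralCharge q M z) (hq0 : q ≠ 0)
    (hq2 : q ^ 2 ≠ 1) (hz : z ≠ 0) {l : ℂ} (hl : l ≠ 0) {v : M}
    (hv : v ∈ highestWeightSpace q M l) (hgen : Submodule.span (Uq q) {v} = ⊤)
    {u : M} (hu0 : u ≠ 0) {m : ℂ} (hK : K q • u = m • u) : ∃ k : ℕ, m = l * q⁻¹ ^ k := by
  have hu : u ∈ Submodule.span ℂ (Set.range fun p : ℕ × ℕ => monomialVector q z v p.1 p.2) := by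
    rw [span_monomialVector hZ hq0 hq2 hz hl hv hgen]; trivial
  have hu2 := mem_span_eigenvectors (Algebra.lsmul ℂ ℂ M (K q)) (l := m) ?_ hu hK
  · by_contra! hcon
    refine hu0 ((Submodule.mem_bot ℂ).1 ((Submodule.span_le (p := ⊥)).2 ?_ hu2))
    rintro _ ⟨⟨⟨j, i⟩, rfl⟩, hs⟩
    have hs' := (K_smul_monomialVector hZ hq0 hq2 hl hv j i).symm.trans hs
    by_contra h0
    exact hcon _ (smul_left_injective ℂ h0 hs').symm
  · rintro _ ⟨⟨j, i⟩, rfl⟩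
    exact ⟨_, K_smul_monomialVector hZ hq0 hq2 hl hv j i⟩

theorem iSup_weightSpace_of_generated (hZ : HasCentralCharge q M z) (hq0 : q ≠ 0)
    (hq2 : q ^ 2 ≠ 1) (hz : z ≠ 0) {n : ℤ} {v : M}
    (hv : v ∈ highestWeightSpace q M (q ^ n)) (hgen : Submodule.span (Uq q) {v} = ⊤) :
    ⨆ m : ℤ, weightSpace q M (q ^ m) = ⊤ := by
  have hl := zpow_ne_zero n hq0
  rw [eq_top_iff, ← span_monomialVector hZ hq0 hq2 hz hl hv hgen, Submodule.span_le]
  rintro _ ⟨⟨j, i⟩, rfl⟩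
  refine Submodule.mem_iSup_of_mem (n - (j + 2 * i : ℕ)) (mem_weightSpace.2 ?_)
  rw [K_smul_monomialVector hZ hq0 hq2 hl hv, zpow_sub₀ hq0, zpow_natCast, inv_pow,
    div_eq_mul_inv]

/-- A nonzero submodule of a weight module contains a weight vector. -/
theorem exists_weight_vector_mem (h : ⨆ m : ℤ, weightSpace q M (q ^ m) = ⊤)
    {S : Submodule (Uq q) M} (hS : S ≠ ⊥) : ∃ m : ℤ, ∃ u ∈ S, u ≠ 0 ∧ K q • u = q ^ m • u := by
  have key : ∀ (s : Finset ℤ) (x : M), x ∈ ⨆ m ∈ s, weightSpace q M (q ^ m) → x ∈ S → x ≠ 0 →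
      ∃ m : ℤ, ∃ u ∈ S, u ≠ 0 ∧ K q • u = q ^ m • u := by
    intro s
    induction s using Finset.induction_on with
    | empty => intro x hx _ h0; simp at hx; exact absurd hx h0
    | insert m s _ ih =>
      intro x hx hxS hx0
      by_cases hK : K q • x = q ^ m • x
      · exact ⟨m, x, hxS, hx0, hK⟩
      -- Applying K - q^m stays in `S` and removes the component of weight q^m, so the support
      -- shrinks.
      refine ih (K q • x - q ^ m • x) ?_ (S.sub_mem (S.smul_mem _ hxS) (S.smul_of_tower_mem _ hxS))
        (sub_ne_zero.2 hK)
      rw [Finset.iSup_insert] at hx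
      obtain ⟨a, ha, b, hb, rfl⟩ := Submodule.mem_sup.1 hx
      rw [smul_add, smul_add, mem_weightSpace.1 ha, add_sub_add_left_eq_sub]
      refine Submodule.sub_mem _ ?_ (Submodule.smul_mem _ _ hb)
      refine (iSup₂_le fun k hk y hy => ?_ : ⨆ m ∈ s, weightSpace q M (q ^ m) ≤
        (⨆ m ∈ s, weightSpace q M (q ^ m)).comap (Algebra.lsmul ℂ ℂ M (K q))) hb
      change K q • y ∈ ⨆ m ∈ s, weightSpace q M (q ^ m)
      rw [mem_weightSpace.1 hy]
      exact Submodule.smul_mem _ _ (Submodule.mem_iSup_of_mem k (Submodule.mem_iSup_of_mem hk hy))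
  obtain ⟨x, hxS, hx0⟩ := S.exists_mem_ne_zero_of_ne_bot hS
  obtain ⟨s, hs⟩ := (Submodule.mem_iSup_iff_exists_finset (m := x)).1 (h ▸ Submodule.mem_top)
  exact key s x hs hxS hx0

end Weights

/-! ### Verma modules: nonvanishing, universal property, simplicity. -/

section Verma

variable {q l z : ℂ}

/-- The representation of `U_q(𝔰)` on functions on `ℤ × ℤ` given by `modelAct`. -/
def modelRep (hq0 : q ≠ 0) (hq2 : q ^ 2 ≠ 1) (hl : l ≠ 0) (hz : z ≠ 0) :
    Uq q →ₐ[ℂ] Module.End ℂ (ℤ → ℤ → ℂ) :=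
  RingQuot.liftAlgHom ℂ ⟨FreeAlgebra.lift ℂ (modelAct q l z), modelAct_rel hq0 hq2 hl hz⟩

theorem modelRep_gen (hq0 : q ≠ 0) (hq2 : q ^ 2 ≠ 1) (hl : l ≠ 0) (hz : z ≠ 0) (g : Gen) :
    modelRep hq0 hq2 hl hz (gen q g) = modelAct q l z g :=
  (RingQuot.liftAlgHom_mkAlgHom_apply ..).trans (FreeAlgebra.lift_ι_apply ..)

theorem highestVector_ne_zero (hq0 : q ≠ 0) (hq2 : q ^ 2 ≠ 1) (hl : l ≠ 0) (hz : z ≠ 0) :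
    highestVector q l z ≠ 0 := by
  set ρ := modelRep hq0 hq2 hl hz
  have hρ : ∀ g, ρ (gen q g) = modelAct q l z g := modelRep_gen hq0 hq2 hl hz
  let e : ℤ → ℤ → ℂ := fun j i => if j = 0 then if i = 0 then 1 else 0 else 0
  -- The annihilator of the delta function `e` at the origin is a left ideal containing the four
  -- generators of the Verma ideal; it does not contain 1.
  let I : Submodule (Uq q) (Uq q) :=
    { carrier := {a | ρ a e = 0}
      add_mem' := fun {a b} (ha : ρ a e = 0) (hb : ρ b e = 0) => by
        change ρ (a + b) e = 0
        rw [map_add, LinearMap.add_apply, ha, hb, add_zero]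
      zero_mem' := by
        change ρ 0 e = 0
        rw [map_zero, LinearMap.zero_apply]
      smul_mem' := fun a b (hb : ρ b e = 0) => by
        change ρ (a * b) e = 0
        rw [map_mul, Module.End.mul_apply, hb, map_zero] }
  intro h
  have h1 : (1 : Uq q) ∈ I := by
    refine Submodule.span_le.2 ?_ ((Submodule.Quotient.mk_eq_zero _).1 h)
    rintro _ (rfl | rfl | rfl | rfl)
    · change ρ (E q) e = 0
      rw [hρ]
      ext j i
      by_cases h : j + 2 = 0
      · have hj : j ≠ 0 := by omega
        simp [modelAct, e, h, hj]
      · by_cases h' : i + 1 = 0 <;> simp [modelAct, e, h, h']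
    · change ρ (X q) e = 0
      rw [hρ]
      ext j i
      by_cases h : j + 1 = 0 <;> simp [modelAct, e, h]
    · change ρ (K q - algebraMap ℂ (Uq q) l) e = 0
      rw [map_sub, AlgHom.commutes, hρ]
      ext j i
      by_cases h : j = 0 <;> by_cases h' : i = 0 <;>
        simp [modelAct, e, h, h', Module.algebraMap_end_apply]
    · change ρ (Z q - algebraMap ℂ (Uq q) z) e = 0
      rw [map_sub, AlgHom.commutes, hρ]
      ext j i
      simp [modelAct, Module.algebraMap_end_apply]
  have h2 : ρ 1 e = 0 := h1
  rw [map_one] at h2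
  simpa [e] using congrFun (congrFun h2 0) 0

theorem smul_highestVector {u : Uq q} {a : ℂ}
    (h : u - algebraMap ℂ (Uq q) a ∈ Submodule.span (Uq q)
      ({E q, X q, K q - algebraMap ℂ (Uq q) l, Z q - algebraMap ℂ (Uq q) z} : Set (Uq q))) :
    u • highestVector q l z = a • highestVector q l z := by
  rw [← algebraMap_smul (Uq q) a (highestVector q l z), highestVector,
    ← Submodule.Quotient.mk_smul, ← Submodule.Quotient.mk_smul, Submodule.Quotient.eq]
  simpa using h

theorem span_highestVector : Submodule.span (Uq q) {highestVector q l z} = ⊤ := by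
  rw [eq_top_iff]
  intro x _
  obtain ⟨a, rfl⟩ := Submodule.Quotient.mk_surjective _ x
  refine Submodule.mem_span_singleton.2 ⟨a, ?_⟩
  rw [highestVector, ← Submodule.Quotient.mk_smul, smul_eq_mul, mul_one]

theorem highestVector_mem : highestVector q l z ∈ highestWeightSpace q (Verma q l z) l := by
  refine mem_highestWeightSpace.2 ⟨?_, ?_, ?_⟩
  · simpa using smul_highestVector (u := E q) (a := 0) (l := l) (z := z)
      (by simpa using Submodule.subset_span (by simp))
  · simpa using smul_highestVector (u := X q) (a := 0) (l := l) (z := z)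
      (by simpa using Submodule.subset_span (by simp))
  · exact smul_highestVector (Submodule.subset_span (by simp))

theorem hasCentralCharge_verma : HasCentralCharge q (Verma q l z) z := by
  intro v
  have hv : v ∈ Submodule.span (Uq q) {highestVector q l z} := by
    rw [span_highestVector]; trivial
  obtain ⟨a, rfl⟩ := Submodule.mem_span_singleton.1 hv
  rw [← mul_smul, Z_mul_comm, mul_smul,
    smul_highestVector (u := Z q) (a := z) (Submodule.subset_span (by simp)), uq_smul_comm]

/-- The universal property of Verma modules. -/
def vermaLift {M : Type} [AddCommGroup M] [Module ℂ M] [Module (Uq q) M]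
    [IsScalarTower ℂ (Uq q) M] (hZ : HasCentralCharge q M z) (v : highestWeightSpace q M l) :
    Verma q l z →ₗ[Uq q] M :=
  Submodule.liftQ _ (LinearMap.toSpanSingleton (Uq q) M v) (by
    obtain ⟨hE, hX, hK⟩ := mem_highestWeightSpace.1 v.2
    rw [Submodule.span_le]
    rintro _ (rfl | rfl | rfl | rfl)
    · exact hE
    · exact hX
    · change (K q - algebraMap ℂ (Uq q) l) • (v : M) = 0
      rw [sub_smul, algebraMap_smul, hK, sub_self]
    · change (Z q - algebraMap ℂ (Uq q) z) • (v : M) = 0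
      rw [sub_smul, algebraMap_smul, hZ, sub_self])

theorem vermaLift_highestVector {M : Type} [AddCommGroup M] [Module ℂ M] [Module (Uq q) M]
    [IsScalarTower ℂ (Uq q) M] (hZ : HasCentralCharge q M z) (v : highestWeightSpace q M l) :
    vermaLift hZ v (highestVector q l z) = v := by
  refine (Submodule.liftQ_apply _ _ _).trans ?_
  simp

variable (hq0 : q ≠ 0) (hq : ∀ k : ℕ, 0 < k → q ^ k ≠ 1) (hz : z ≠ 0)
include hq0 hq hz

theorem weight_eq_of_mem_highestWeightSpace_verma {m n : ℤ} {u : Verma q (q ^ n) z} (hu0 : u ≠ 0)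
    (hu : u ∈ highestWeightSpace q (Verma q (q ^ n) z) (q ^ m)) : m = n := by
  have hq2 := hq 2 (by norm_num)
  have hn := zpow_ne_zero n hq0
  obtain ⟨hE, hX, hK⟩ := mem_highestWeightSpace.1 hu
  obtain ⟨i, hi⟩ := exists_weight_of_X_smul_eq_zero hasCentralCharge_verma hq0 hq hz
    highestVector_mem span_highestVector hu0 hX hK
  have h1 := casimirTilde_smul_of_generated hasCentralCharge_verma hq0 hq2 hz hn highestVector_mem
    span_highestVector u
  rw [casimirTilde_smul_of_highest hq0 hq2 (zpow_ne_zero m hq0) hE hX hK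
    (hasCentralCharge_verma u)] at h1
  rcases (centralValue_eq_iff hq0 hq hz m n).1 (smul_left_injective ℂ hu0 h1) with h | h
  · exact h
  -- Parity: n - 2i = -n - 3 would make 3 even.
  · omega

theorem highestWeightSpace_verma (n : ℤ) : highestWeightSpace q (Verma q (q ^ n) z) (q ^ n) =
    Submodule.span ℂ {highestVector q (q ^ n) z} := by
  refine le_antisymm (fun u hu => ?_) ?_
  · exact mem_span_of_K_smul hasCentralCharge_verma hq0 hq hz (zpow_ne_zero n hq0)
      highestVector_mem span_highestVector (mem_highestWeightSpace.1 hu).2.2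
  · rw [Submodule.span_singleton_le_iff_mem]
    exact highestVector_mem

theorem isSimpleModule_verma (n : ℤ) : IsSimpleModule (Uq q) (Verma q (q ^ n) z) := by
  have hq2 := hq 2 (by norm_num)
  have hn := zpow_ne_zero n hq0
  have hne := highestVector_ne_zero hq0 hq2 hn hz
  have : Nontrivial (Verma q (q ^ n) z) := ⟨_, _, hne⟩
  rw [isSimpleModule_iff]
  refine { eq_bot_or_eq_top := fun S => or_iff_not_imp_left.2 fun hS => ?_ }
  have hZ := hasCentralCharge_verma (q := q) (l := q ^ n) (z := z)
  obtain ⟨m, u, huS, hu0, hK⟩ := exists_weight_vector_mem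
    (iSup_weightSpace_of_generated hZ hq0 hq2 hz highestVector_mem span_highestVector) hS
  have hbd : ∀ m : ℤ, (∃ u ∈ S, u ≠ 0 ∧ K q • u = q ^ m • u) → m ≤ n := by
    rintro m ⟨u, -, hu0, hK⟩
    obtain ⟨k, hk⟩ := exists_weight_of_ne_zero hZ hq0 hq2 hz hn highestVector_mem
      span_highestVector hu0 hK
    have : m = n - k := zpow_injective hq0 hq (by
      simp only
      rw [hk, zpow_sub₀ hq0, zpow_natCast, inv_pow, div_eq_mul_inv])
    omega
  -- `E` and `X` raise the exponent of the weight, so a weight vector of `S` of maximal exponent is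
  -- a highest weight vector.
  obtain ⟨m, ⟨u, huS, hu0, hK⟩, hmax⟩ := Int.exists_greatest_of_bdd ⟨n, hbd⟩ ⟨m, u, huS, hu0, hK⟩
  have hu : u ∈ highestWeightSpace q (Verma q (q ^ n) z) (q ^ m) := by
    refine mem_highestWeightSpace.2 ⟨?_, ?_, hK⟩
    · by_contra h
      have := hmax (m + 2) ⟨E q • u, S.smul_mem _ huS, h, by
        rw [K_smul_E hK, zpow_add₀ hq0, mul_comm]; norm_cast⟩
      omega
    · by_contra h
      have := hmax (m + 1) ⟨X q • u, S.smul_mem _ huS, h, by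
        rw [K_smul_X hK, zpow_add_one₀ hq0, mul_comm]⟩
      omega
  obtain rfl := weight_eq_of_mem_highestWeightSpace_verma hq0 hq hz hu0 hu
  rw [highestWeightSpace_verma hq0 hq hz] at hu
  obtain ⟨a, rfl⟩ := Submodule.mem_span_singleton.1 hu
  have ha : a ≠ 0 := by rintro rfl; simp at hu0
  rw [eq_top_iff, ← span_highestVector, Submodule.span_singleton_le_iff_mem]
  have := S.smul_of_tower_mem a⁻¹ huS
  rwa [inv_smul_smul₀ ha] at this

theorem isEmpty_verma_equiv (n : ℤ) :
    IsEmpty (Verma q (q ^ n) z ≃ₗ[Uq q] Verma q (q ^ (-n - 3)) z) := by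
  refine ⟨fun e => ?_⟩
  have h := map_mem_highestWeightSpace e.toLinearMap
    (highestVector_mem (l := q ^ n))
  have hne := highestVector_ne_zero hq0 (hq 2 (by norm_num)) (zpow_ne_zero n hq0) hz
  have := weight_eq_of_mem_highestWeightSpace_verma hq0 hq hz (by simpa using hne) h
  omega

end Verma

/-! ### Modules of a block are generated by highest weight vectors. -/

section Admissible

/-- The properties of the objects of a block that force them to be generated by highest weight
vectors. -/
structure IsAdmissible (q : ℂ) (M : Type) [AddCommGroup M] [Module ℂ M] [Module (Uq q) M]
    [IsScalarTower ℂ (Uq q) M] (c z : ℂ) : Prop where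
  centralCharge : HasCentralCharge q M z
  weights : ⨆ m : ℤ, weightSpace q M (q ^ m) = ⊤
  nilpotent_X : ∀ (m : ℤ) (v : M), K q • v = q ^ m • v → ∃ k : ℕ, X q ^ k • v = 0
  nilpotent_E : ∀ (m : ℤ) (v : M), K q • v = q ^ m • v → ∃ k : ℕ, E q ^ k • v = 0
  casimir : ∃ k : ℕ, ∀ v : M, (casimirTilde q - algebraMap ℂ (Uq q) c) ^ k • v = 0

variable {q : ℂ} {M : Type} [AddCommGroup M] [Module ℂ M] [Module (Uq q) M]
  [IsScalarTower ℂ (Uq q) M] {c z : ℂ}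

/-- If no power killed `v`, the vectors g^k v would have pairwise distinct `K`-eigenvalues, hence be
independent inside a finite-dimensional space. -/
theorem IsLocallyFinite.exists_pow_smul_eq_zero (hq0 : q ≠ 0) (hq : ∀ k : ℕ, 0 < k → q ^ k ≠ 1)
    (hM : IsLocallyFinite q M) {g : Uq q} (hg : g ∈ nPlus q) {d : ℤ} (hd : d ≠ 0)
    (hK : ∀ (m : ℤ) (v : M), K q • v = q ^ m • v → K q • g • v = q ^ (m + d) • g • v)
    (m : ℤ) (v : M) (hv : K q • v = q ^ m • v) : ∃ k : ℕ, g ^ k • v = 0 := by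
  by_contra! hcon
  have := hM v
  set W := (Subalgebra.toSubmodule (nPlus q)).map
    ((LinearMap.toSpanSingleton (Uq q) M v).restrictScalars ℂ)
  have hW : ∀ k : ℕ, g ^ k • v ∈ W := fun k =>
    ⟨g ^ k, (nPlus q).pow_mem hg k, rfl⟩
  have hwt : ∀ k : ℕ, K q • g ^ k • v = q ^ (m + d * k) • g ^ k • v := by
    intro k
    induction k with
    | zero => simpa using hv
    | succ k ih =>
      rw [pow_succ', mul_smul, hK _ _ ih]
      congr 2
      push_cast
      ring
  have hli := Module.End.eigenvectors_linearIndependent' (Algebra.lsmul ℂ ℂ M (K q))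
    (fun k : ℕ => q ^ (m + d * k)) (fun a b h => by
      have := zpow_injective hq0 hq h
      simpa [hd] using this) (fun k => g ^ k • v)
    (fun k => ⟨mem_weightSpace.2 (hwt k), hcon k⟩)
  have hli' : LinearIndependent ℂ (fun k : ℕ => (⟨g ^ k • v, hW k⟩ : W)) :=
    LinearIndependent.of_comp W.subtype hli
  have := hli'.finite_of_isNoetherian
  exact not_finite ℕ

theorem IsInGenBlock.isAdmissible (hq0 : q ≠ 0) (hq : ∀ k : ℕ, 0 < k → q ^ k ≠ 1)
    (hM : IsInGenBlock q M c z) (hZ : HasCentralCharge q M z) : IsAdmissible q M c z where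
  centralCharge := hZ
  weights := by
    rw [eq_top_iff, ← hM.inO.weight.submodule_iSup_eq_top]
    refine iSup_le fun l => ?_
    by_cases h : weightSpace q M l = ⊥
    · rw [h]; exact bot_le
    · obtain ⟨m, hm⟩ := hM.supp_subset ⟨l.ne_zero, h⟩
      rw [← hm]
      exact le_iSup (fun m : ℤ => weightSpace q M (q ^ m)) m
  nilpotent_X := hM.inO.locallyFinite.exists_pow_smul_eq_zero hq0 hq
    (Algebra.subset_adjoin (by simp)) one_ne_zero fun m v hv => by
      rw [K_smul_X hv, zpow_add₀ hq0, mul_comm, zpow_one]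
  nilpotent_E := hM.inO.locallyFinite.exists_pow_smul_eq_zero hq0 hq
    (Algebra.subset_adjoin (by simp)) two_ne_zero fun m v hv => by
      rw [K_smul_E hv, zpow_add₀ hq0, mul_comm]; norm_cast
  casimir := by
    obtain ⟨k, hk⟩ := hM.annihilated
    exact ⟨k, fun v => by simpa using hk k 0 (add_zero k) v⟩

variable (hM : IsAdmissible q M c z)
include hM

theorem IsAdmissible.centralValue_eq (hq0 : q ≠ 0) (hq2 : q ^ 2 ≠ 1) {l : ℂ} (hl : l ≠ 0)
    {u : M} (hu : u ∈ highestWeightSpace q M l) (hu0 : u ≠ 0) : centralValue q l z = c := by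
  obtain ⟨hE, hX, hK⟩ := mem_highestWeightSpace.1 hu
  obtain ⟨k, hk⟩ := hM.casimir
  have h : ∀ k : ℕ, (casimirTilde q - algebraMap ℂ (Uq q) c) ^ k • u =
      (centralValue q l z - c) ^ k • u := by
    intro k
    induction k with
    | zero => simp
    | succ k ih =>
      rw [pow_succ', mul_smul, ih, uq_smul_comm, sub_smul (casimirTilde q), algebraMap_smul,
        casimirTilde_smul_of_highest hq0 hq2 hl hE hX hK (hM.centralCharge u), ← sub_smul,
        smul_smul, ← pow_succ]
  have h0 := (h k).symm.trans (hk u)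
  exact sub_eq_zero.1 (eq_zero_of_pow_eq_zero ((smul_eq_zero.1 h0).resolve_right hu0))

/-- Take the last nonzero vector of the `E`-string of `u`; `E` preserves ker X. -/
theorem IsAdmissible.exists_E_pow_smul_mem (hq0 : q ≠ 0) {m : ℤ} {u : M} (hu0 : u ≠ 0)
    (hX : X q • u = 0) (hK : K q • u = q ^ m • u) :
    ∃ t : ℕ, E q ^ t • u ≠ 0 ∧ E q ^ t • u ∈ highestWeightSpace q M (q ^ (m + 2 * t)) := by
  classical
  have hex := hM.nilpotent_E m u hK
  have hwt : ∀ t : ℕ, X q • E q ^ t • u = 0 ∧ K q • E q ^ t • u = q ^ (m + 2 * t) • E q ^ t • u := by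
    intro t
    induction t with
    | zero => simpa using ⟨hX, hK⟩
    | succ t ih =>
      rw [pow_succ', mul_smul]
      refine ⟨X_smul_E hq0 ih.1, ?_⟩
      rw [K_smul_E ih.2]
      congr 1
      push_cast
      rw [mul_add, ← add_assoc, zpow_add₀ hq0 (m + 2 * t), mul_comm]
      norm_cast
  rcases h : Nat.find hex with _ | t
  · have := Nat.find_spec hex
    rw [h] at this
    simp [hu0] at this
  · refine ⟨t, Nat.find_min hex (by omega), mem_highestWeightSpace.2 ⟨?_, hwt t⟩⟩
    have := Nat.find_spec hex
    rwa [h, pow_succ', mul_smul] at this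

/-- Induction on the distance `s` below the top of the string. This step excludes nontrivial
extensions: every vector of ker X on the string comes from its top. -/
theorem IsAdmissible.mem_span_of_X_smul_eq_zero (hq0 : q ≠ 0) (hq : ∀ k : ℕ, 0 < k → q ^ k ≠ 1)
    (hz : z ≠ 0) {p : ℤ} (hp : centralValue q (q ^ p) z = c) (s : ℕ) {u : M} (hX : X q • u = 0)
    (hK : K q • u = q ^ (p - 2 * s) • u) :
    u ∈ Submodule.span (Uq q) (highestWeightSpace q M (q ^ p) : Set M) := by
  have hq2 := hq 2 (by norm_num)
  set W := Submodule.span (Uq q) (highestWeightSpace q M (q ^ p) : Set M)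
  induction s generalizing u with
  | zero =>
    by_cases hu0 : u = 0
    · rw [hu0]; exact W.zero_mem
    obtain ⟨t, ht0, ht⟩ := hM.exists_E_pow_smul_mem hq0 hu0 hX hK
    have := hM.centralValue_eq hq0 hq2 (zpow_ne_zero _ hq0) ht ht0
    rw [← hp, centralValue_eq_iff hq0 hq hz] at this
    -- The exponent p + 2t must be p or -p - 3, and the latter has the wrong parity; so `u` itself
    -- is a highest weight vector.
    obtain rfl : t = 0 := by
      push_cast at this
      omega
    refine Submodule.subset_span ?_
    simpa using ht
  | succ s ih =>
    -- The exponent p - 2(s + 1) is neither p nor, by parity, -p - 3.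
    have hd : centralValue q (q ^ (p - 2 * (s + 1 : ℕ))) z - c ≠ 0 := by
      rw [sub_ne_zero, ← hp, Ne, centralValue_eq_iff hq0 hq hz]
      push_cast
      omega
    have hmn := zpow_ne_zero (p - 2 * (s + 1 : ℕ)) hq0
    -- Inner induction on the exponent of nilpotency of C̃ - c: both (C̃ - c)w and F'Ew are already
    -- in `W`, and they differ by a nonzero multiple of w.
    have key : ∀ (k : ℕ) (w : M), X q • w = 0 → K q • w = q ^ (p - 2 * (s + 1 : ℕ)) • w →
        (casimirTilde q - algebraMap ℂ (Uq q) c) ^ k • w = 0 → w ∈ W := by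
      intro k
      induction k with
      | zero => intro w _ _ h; rw [pow_zero, one_smul] at h; rw [h]; exact W.zero_mem
      | succ k ihk =>
        intro w hX hK h
        have hEX := X_smul_E hq0 hX
        have hEK : K q • E q • w = q ^ (p - 2 * (s : ℤ)) • E q • w := by
          rw [K_smul_E hK]
          congr 1
          rw [show p - 2 * (s : ℤ) = 2 + (p - 2 * (s + 1 : ℕ)) by push_cast; ring, zpow_add₀ hq0 2]
          norm_cast
        have hE0 := zpow_ne_zero (p - 2 * (s : ℤ)) hq0
        have hC : (casimirTilde q - algebraMap ℂ (Uq q) c) • w =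
            (1 + q) • lowering q z • E q • w +
              (centralValue q (q ^ (p - 2 * (s + 1 : ℕ))) z - c) • w := by
          rw [sub_smul, casimirTilde_smul_of_X_smul_eq_zero hM.centralCharge hq0 hq2 hmn hX hK,
            algebraMap_smul, sub_smul, add_sub_assoc]
        have hL : lowering q z • E q • w ∈ W := W.smul_mem _ (ih hEX hEK)
        have h1 : (casimirTilde q - algebraMap ℂ (Uq q) c) • w ∈ W := by
          refine ihk _ ?_ ?_ (by rwa [← mul_smul, ← pow_succ])
          · rw [hC, smul_add, uq_smul_comm, uq_smul_comm, hX,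
              X_smul_lowering hM.centralCharge hq2 hE0 hEX hEK, smul_zero, smul_zero, add_zero]
          · rw [hC, smul_add, uq_smul_comm, uq_smul_comm, hK, smul_add,
              K_smul_lowering hq0 z hE0 hEK]
            congr 1
            · rw [smul_comm (1 + q)]
              congr 1
              rw [show p - 2 * (s : ℤ) = 2 + (p - 2 * (s + 1 : ℕ)) by push_cast; ring,
                zpow_add₀ hq0 2, ← mul_assoc]
              norm_cast
              rw [inv_mul_cancel₀ (pow_ne_zero 2 hq0), one_mul]
            · rw [smul_comm]
        rw [hC] at h1
        have h2 := (W.add_mem_iff_right (W.smul_of_tower_mem (1 + q) hL)).1 h1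
        have h3 := W.smul_of_tower_mem (centralValue q (q ^ (p - 2 * (s + 1 : ℕ))) z - c)⁻¹ h2
        rwa [inv_smul_smul₀ hd] at h3
    obtain ⟨k, hk⟩ := hM.casimir
    exact key k u hX hK (hk u)

/-- Admissible modules are generated by their highest weight vectors. -/
theorem IsAdmissible.span_eq_top (hq0 : q ≠ 0) (hq : ∀ k : ℕ, 0 < k → q ^ k ≠ 1)
    (hz : z ≠ 0) {n : ℤ} (hn : centralValue q (q ^ n) z = c) :
    Submodule.span (Uq q) (highestWeightSpace q M (q ^ n) ∪
      highestWeightSpace q M (q ^ (-n - 3)) : Set M) = ⊤ := by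
  have hq2 := hq 2 (by norm_num)
  have hn' : centralValue q (q ^ (-n - 3)) z = c := by
    rw [← hn, centralValue_eq_iff hq0 hq hz]; exact Or.inr rfl
  set W := Submodule.span (Uq q) (highestWeightSpace q M (q ^ n) ∪
    highestWeightSpace q M (q ^ (-n - 3)) : Set M)
  -- The `E`-string of `u` ends in one of the two weights, which decides the string to which the
  -- previous lemma applies.
  have hN : ∀ (m : ℤ) (u : M), X q • u = 0 → K q • u = q ^ m • u → u ∈ W := by
    intro m u hX hK
    by_cases hu0 : u = 0
    · rw [hu0]; exact W.zero_mem
    obtain ⟨t, ht0, ht⟩ := hM.exists_E_pow_smul_mem hq0 hu0 hX hK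
    have h := hM.centralValue_eq hq0 hq2 (zpow_ne_zero _ hq0) ht ht0
    rw [← hn, centralValue_eq_iff hq0 hq hz] at h
    rcases h with h | h
    · refine Submodule.span_mono Set.subset_union_left
        (hM.mem_span_of_X_smul_eq_zero hq0 hq hz hn t hX ?_)
      rwa [← h, add_sub_cancel_right]
    · refine Submodule.span_mono Set.subset_union_right
        (hM.mem_span_of_X_smul_eq_zero hq0 hq hz hn' t hX ?_)
      rwa [← h, add_sub_cancel_right]
  have hXK : ∀ (j : ℕ) (m : ℤ) (u : M), K q • u = q ^ m • u →
      K q • X q ^ j • u = q ^ (m + j) • X q ^ j • u := by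
    intro j m u hu
    induction j with
    | zero => simpa using hu
    | succ j ih =>
      rw [pow_succ', mul_smul, K_smul_X ih]
      congr 1
      push_cast
      rw [← add_assoc, zpow_add_one₀ hq0, mul_comm]
  have hYK : ∀ (j : ℕ) (m : ℤ) (u : M), K q • u = q ^ (m + j) • u →
      K q • Y q ^ j • u = q ^ m • Y q ^ j • u := by
    intro j m u hu
    induction j generalizing m with
    | zero => simpa using hu
    | succ j ih =>
      rw [pow_succ', mul_smul, K_smul_Y (ih (m + 1) (by
        rw [hu]; congr 2; push_cast; ring))]
      congr 1
      rw [zpow_add_one₀ hq0, mul_comm, mul_assoc, mul_inv_cancel₀ hq0, mul_one]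
  have key : ∀ (j : ℕ) (m : ℤ) (u : M), K q • u = q ^ m • u → X q ^ j • u = 0 → u ∈ W := by
    intro j
    induction j with
    | zero => intro m u _ h; rw [pow_zero, one_smul] at h; rw [h]; exact W.zero_mem
    | succ j ih =>
      intro m u hK h
      rw [pow_succ', mul_smul] at h
      obtain ⟨a, ha, hXY⟩ := X_pow_smul_Y_pow hM.centralCharge hz hq j
      have h1 : X q ^ j • u ∈ W := hN _ _ h (hXK j m u hK)
      -- Since X^j u is in ker X, the vector a⁻¹ Y^j X^j u has the same image under X^j as `u`;
      -- subtracting it lowers the order of nilpotency.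
      have h2 : u - a⁻¹ • Y q ^ j • X q ^ j • u ∈ W := by
        refine ih m _ ?_ ?_
        · rw [smul_sub, uq_smul_comm, hK, hYK j m _ (hXK j m u hK), smul_sub, smul_comm a⁻¹]
        · rw [smul_sub, uq_smul_comm, hXY _ h, inv_smul_smul₀ ha, sub_self]
      exact (W.sub_mem_iff_left (W.smul_of_tower_mem _ (W.smul_mem _ h1))).1 h2
  rw [eq_top_iff]
  intro x _
  have hx : x ∈ ⨆ m : ℤ, weightSpace q M (q ^ m) := by rw [hM.weights]; trivial
  refine (iSup_le fun m u hu => ?_ : ⨆ m : ℤ, weightSpace q M (q ^ m) ≤ W.restrictScalars ℂ) hx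
  rw [mem_weightSpace] at hu
  obtain ⟨k, hk⟩ := hM.nilpotent_X m u hu
  exact key k m u hu hk

end Admissible

/-! ### Criterion for membership in a block, and decomposition into Verma modules. -/

section Criterion

set_option linter.unusedSectionVars false

variable {q : ℂ} {M : Type} [AddCommGroup M] [Module ℂ M] [Module (Uq q) M]
  [IsScalarTower ℂ (Uq q) M] {z : ℂ}

variable (q) in
/-- `v` lies in a finite-dimensional subspace stable under `E` and `X`. -/
def IsFiniteVector (v : M) : Prop :=
  ∃ T : Submodule ℂ M, FiniteDimensional ℂ T ∧ v ∈ T ∧ ∀ x ∈ T, E q • x ∈ T ∧ X q • x ∈ T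

theorem IsFiniteVector.add {v w : M} (hv : IsFiniteVector q v) (hw : IsFiniteVector q w) :
    IsFiniteVector q (v + w) := by
  obtain ⟨T, hT, hvT, hs⟩ := hv
  obtain ⟨T', hT', hwT, hs'⟩ := hw
  refine ⟨T ⊔ T', inferInstance, Submodule.add_mem_sup hvT hwT, fun x hx => ?_⟩
  obtain ⟨a, ha, b, hb, rfl⟩ := Submodule.mem_sup.1 hx
  rw [smul_add, smul_add]
  exact ⟨Submodule.add_mem_sup (hs a ha).1 (hs' b hb).1,
    Submodule.add_mem_sup (hs a ha).2 (hs' b hb).2⟩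

theorem IsFiniteVector.zero : IsFiniteVector q (0 : M) :=
  ⟨⊥, inferInstance, Submodule.zero_mem _, fun x hx => by
    rw [(Submodule.mem_bot ℂ).1 hx]; simp⟩

theorem IsFiniteVector.smul (a : ℂ) {v : M} (hv : IsFiniteVector q v) :
    IsFiniteVector q (a • v) := by
  obtain ⟨T, hT, hvT, hs⟩ := hv
  exact ⟨T, hT, T.smul_mem a hvT, hs⟩

theorem IsFiniteVector.map {N : Type} [AddCommGroup N] [Module ℂ N] [Module (Uq q) N]
    [IsScalarTower ℂ (Uq q) N] (f : M →ₗ[Uq q] N) {v : M} (hv : IsFiniteVector q v) :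
    IsFiniteVector q (f v) := by
  obtain ⟨T, hT, hvT, hs⟩ := hv
  refine ⟨T.map (f.restrictScalars ℂ), inferInstance, ⟨v, hvT, rfl⟩, ?_⟩
  rintro _ ⟨x, hx, rfl⟩
  exact ⟨⟨E q • x, (hs x hx).1, f.map_smul _ _⟩, ⟨X q • x, (hs x hx).2, f.map_smul _ _⟩⟩

theorem isLocallyFinite_of_isFiniteVector (h : ∀ v : M, IsFiniteVector q v) :
    IsLocallyFinite q M := by
  intro v
  obtain ⟨T, hT, hvT, hs⟩ := h v
  refine Submodule.finiteDimensional_of_le (S₂ := T) ?_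
  rintro _ ⟨a, ha, rfl⟩
  refine adjoin_smul_mem (s := {E q, X q}) T ?_ ha v hvT
  rintro _ (rfl | rfl) x hx
  · exact (hs x hx).1
  · exact (hs x hx).2

theorem isFiniteVector_of_generated (hZ : HasCentralCharge q M z) (hq0 : q ≠ 0)
    (hq2 : q ^ 2 ≠ 1) (hz : z ≠ 0) {l : ℂ} (hl : l ≠ 0) {v : M}
    (hv : v ∈ highestWeightSpace q M l) (hgen : Submodule.span (Uq q) {v} = ⊤) (u : M) :
    IsFiniteVector q u := by
  have hu : u ∈ Submodule.span ℂ (Set.range fun p : ℕ × ℕ => monomialVector q z v p.1 p.2) := by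
    rw [span_monomialVector hZ hq0 hq2 hz hl hv hgen]; trivial
  induction hu using Submodule.span_induction with
  | zero => exact .zero
  | add x y _ _ hx hy => exact hx.add hy
  | smul a x _ hx => exact hx.smul a
  | mem x hx =>
    obtain ⟨⟨j, i⟩, rfl⟩ := hx
    -- Monomials of depth at most that of the given one span a finite-dimensional space stable under
    -- `E` and `X`.
    set A : Set (ℕ × ℕ) := {p | p.1 + 2 * p.2 ≤ j + 2 * i}
    have hA : A.Finite := ((Set.finite_Iic (j + 2 * i)).prod (Set.finite_Iic (j + 2 * i))).subset
      fun p (hp : p.1 + 2 * p.2 ≤ j + 2 * i) => by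
        simp only [Set.mem_prod, Set.mem_Iic]; omega
    set T := Submodule.span ℂ ((fun p : ℕ × ℕ => monomialVector q z v p.1 p.2) '' A)
    have hT : ∀ j' i', j' + 2 * i' ≤ j + 2 * i → monomialVector q z v j' i' ∈ T :=
      fun j' i' h => Submodule.subset_span ⟨(j', i'), h, rfl⟩
    refine ⟨T, FiniteDimensional.span_of_finite ℂ (hA.image _), hT j i le_rfl, fun x hx =>
      ⟨gen_smul_mem_span ?_ hx, gen_smul_mem_span ?_ hx⟩⟩
    · rintro _ ⟨⟨j', i'⟩, h, rfl⟩
      exact E_smul_monomialVector hZ hq0 hq2 hl hv T j' i' fun j'' i'' h' => hT _ _ (h'.trans h)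
    · rintro _ ⟨⟨j', i'⟩, h, rfl⟩
      exact X_smul_monomialVector hZ hq0 hq2 hl hv T j' i' fun j'' i'' h' => hT _ _ (h'.trans h)

theorem isWeightModule_of_iSup (hq0 : q ≠ 0) (h : ⨆ m : ℤ, weightSpace q M (q ^ m) = ⊤) :
    IsWeightModule q M := by
  classical
  refine (DirectSum.isInternal_submodule_iff_iSupIndep_and_iSup_eq_top _).2 ⟨?_, ?_⟩
  · exact (Module.End.eigenspaces_iSupIndep (Algebra.lsmul ℂ ℂ M (K q))).comp Units.val_injective
  · rw [eq_top_iff, ← h]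
    exact iSup_le fun m => le_iSup (fun l : ℂˣ => weightSpace q M (l : ℂ))
      (Units.mk0 (q ^ m) (zpow_ne_zero m hq0))

theorem supp_subset_of_iSup (h : ⨆ m : ℤ, weightSpace q M (q ^ m) = ⊤) :
    supp q M ⊆ Set.range (fun k : ℤ => q ^ k) := by
  rintro l ⟨-, hl⟩
  by_contra hcon
  refine hl (disjoint_self.1 (Disjoint.mono_right ?_
    (Module.End.eigenspaces_iSupIndep (Algebra.lsmul ℂ ℂ M (K q)) l)))
  refine le_trans le_top (h ▸ iSup_le fun m => ?_)
  exact le_iSup₂_of_le (f := fun j (_ : j ≠ l) => Module.End.eigenspace _ j) (q ^ m)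
    (fun h => hcon ⟨m, h⟩) le_rfl

/-- The two exponents of the highest weights in a block. -/
def blockWeight (n : ℤ) : Bool → ℤ
  | true => n
  | false => -n - 3

variable (q M) in
/-- `M` is generated by its highest weight vectors of the weights of the block. -/
def IsHighestGenerated (n : ℤ) : Prop :=
  Submodule.span (Uq q) (⋃ b, (highestWeightSpace q M (q ^ blockWeight n b) : Set M)) = ⊤

theorem isHighestGenerated_verma (n : ℤ) (b : Bool) :
    IsHighestGenerated q (Verma q (q ^ blockWeight n b) z) n := by
  rw [IsHighestGenerated, eq_top_iff, ← span_highestVector]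
  exact Submodule.span_mono (Set.singleton_subset_iff.2 (Set.mem_iUnion.2 ⟨b, highestVector_mem⟩))

/-- The kernel of Z - z is a submodule because `Z` is central, and it is nonzero because Z - z is
nilpotent; a simple module must equal it. -/
theorem IsInGenBlock.hasCentralCharge [IsSimpleModule (Uq q) M] {c : ℂ}
    (hM : IsInGenBlock q M c z) : HasCentralCharge q M z := by
  let N : Submodule (Uq q) M :=
    { carrier := {v | Z q • v = z • v}
      add_mem' := fun {a b} (ha : Z q • a = z • a) (hb : Z q • b = z • b) => by
        change Z q • (a + b) = z • (a + b)
        rw [smul_add, smul_add, ha, hb]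
      zero_mem' := by
        change Z q • (0 : M) = z • (0 : M)
        simp
      smul_mem' := fun a v (hv : Z q • v = z • v) => by
        change Z q • a • v = z • a • v
        rw [← mul_smul, Z_mul_comm, mul_smul, hv, uq_smul_comm] }
  rcases eq_bot_or_eq_top N with h | h
  · exfalso
    obtain ⟨k, hk⟩ := hM.annihilated
    have key : ∀ (k : ℕ) (v : M), (Z q - algebraMap ℂ (Uq q) z) ^ k • v = 0 → v = 0 := by
      intro k
      induction k with
      | zero => intro v hv; simpa using hv
      | succ k ih =>
        intro v hv
        rw [pow_succ, mul_smul] at hv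
        have h1 := ih _ hv
        rw [sub_smul, algebraMap_smul, sub_eq_zero] at h1
        have h2 : v ∈ N := h1
        rwa [h, Submodule.mem_bot] at h2
    have := IsSimpleModule.nontrivial (Uq q) M
    obtain ⟨v, hv⟩ := exists_ne (0 : M)
    exact hv (key k v (by simpa using hk 0 k (zero_add k) v))
  · intro v
    have : v ∈ N := h ▸ Submodule.mem_top
    exact this

variable (hq0 : q ≠ 0) (hq : ∀ k : ℕ, 0 < k → q ^ k ≠ 1) (hz : z ≠ 0)
include hq0 hq hz

theorem centralValue_blockWeight (n : ℤ) (b : Bool) :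
    centralValue q (q ^ blockWeight n b) z = centralValue q (q ^ n) z := by
  rw [centralValue_eq_iff hq0 hq hz]
  cases b <;> simp [blockWeight]

/-- All the conditions pass from Verma modules to their images and to sums of these, and such images
exhaust the module. -/
theorem isInBlock_of_isHighestGenerated [Module.Finite (Uq q) M] (hZ : HasCentralCharge q M z)
    {n : ℤ} (h : IsHighestGenerated q M n) : IsInBlock q M (centralValue q (q ^ n) z) z := by
  have hq2 := hq 2 (by norm_num)
  have key : ∀ x : M, x ∈ ⨆ m : ℤ, weightSpace q M (q ^ m) ∧
      casimirTilde q • x = centralValue q (q ^ n) z • x ∧ IsFiniteVector q x := by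
    intro x
    have hx : x ∈ Submodule.span (Uq q)
        (⋃ b, (highestWeightSpace q M (q ^ blockWeight n b) : Set M)) := by rw [h]; trivial
    rw [← one_smul (Uq q) x]
    -- The claim is strengthened to all multiples a • x, which makes the scalar step of the
    -- induction trivial.
    generalize (1 : Uq q) = a
    induction hx using Submodule.span_induction generalizing a with
    | zero => rw [smul_zero]; exact ⟨Submodule.zero_mem _, by simp, .zero⟩
    | add x y _ _ hx hy =>
      rw [smul_add]
      refine ⟨Submodule.add_mem _ (hx a).1 (hy a).1, ?_, (hx a).2.2.add (hy a).2.2⟩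
      rw [smul_add, (hx a).2.1, (hy a).2.1, smul_add]
    | smul b x _ hx => rw [← mul_smul]; exact hx _
    | mem x hx =>
      obtain ⟨b, hb⟩ := Set.mem_iUnion.1 hx
      set f := vermaLift hZ ⟨x, hb⟩
      have hl := zpow_ne_zero (blockWeight n b) hq0
      have hV := hasCentralCharge_verma (q := q) (l := q ^ blockWeight n b) (z := z)
      obtain ⟨y, hy⟩ : ∃ y, f y = a • x :=
        ⟨a • highestVector _ _ _, by rw [map_smul, vermaLift_highestVector]⟩
      rw [← hy]
      refine ⟨?_, ?_, (isFiniteVector_of_generated hV hq0 hq2 hz hl highestVector_mem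
        span_highestVector y).map f⟩
      · have hyt : y ∈ ⨆ m : ℤ, weightSpace q (Verma q (q ^ blockWeight n b) z) (q ^ m) := by
          rw [iSup_weightSpace_of_generated hV hq0 hq2 hz highestVector_mem span_highestVector]
          trivial
        refine (iSup_le fun m u hu => ?_ :
          ⨆ m : ℤ, weightSpace q (Verma q (q ^ blockWeight n b) z) (q ^ m) ≤
            (⨆ m : ℤ, weightSpace q M (q ^ m)).comap (f.restrictScalars ℂ)) hyt
        refine Submodule.mem_iSup_of_mem m (mem_weightSpace.2 ?_)
        change K q • f u = q ^ m • f u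
        rw [← map_smul, mem_weightSpace.1 hu, ← algebraMap_smul (Uq q), map_smul, algebraMap_smul]
      · rw [← map_smul, casimirTilde_smul_of_generated hV hq0 hq2 hz hl highestVector_mem
          span_highestVector, centralValue_blockWeight hq0 hq hz, ← algebraMap_smul (Uq q),
          map_smul, algebraMap_smul]
  have hw : ⨆ m : ℤ, weightSpace q M (q ^ m) = ⊤ := eq_top_iff.2 fun x _ => (key x).1
  refine ⟨⟨⟨inferInstance, isWeightModule_of_iSup hq0 hw,
    isLocallyFinite_of_isFiniteVector fun v => (key v).2.2⟩, supp_subset_of_iSup hw, 1, ?_⟩, hZ⟩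
  intro i j hij v
  obtain ⟨rfl, rfl⟩ | ⟨rfl, rfl⟩ : i = 1 ∧ j = 0 ∨ i = 0 ∧ j = 1 := by omega
  · rw [pow_one, pow_zero, mul_one, sub_smul, algebraMap_smul, (key v).2.1, sub_self]
  · rw [pow_one, pow_zero, one_mul, sub_smul, algebraMap_smul, hZ v, sub_self]

theorem IsInGenBlock.isHighestGenerated {n : ℤ}
    (hM : IsInGenBlock q M (centralValue q (q ^ n) z) z) (hZ : HasCentralCharge q M z) :
    IsHighestGenerated q M n := by
  rw [IsHighestGenerated, ← (hM.isAdmissible hq0 hq hZ).span_eq_top hq0 hq hz rfl,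
    Set.union_eq_iUnion]
  congr 2
  ext b : 1
  cases b <;> rfl

theorem vermaLift_injective (hZ : HasCentralCharge q M z) {m : ℤ}
    (v : highestWeightSpace q M (q ^ m)) (hv : v ≠ 0) :
    Function.Injective (vermaLift (z := z) hZ v) := by
  have := isSimpleModule_verma hq0 hq hz m
  refine (LinearMap.injective_or_eq_zero _).resolve_right fun h => hv ?_
  have := vermaLift_highestVector hZ v
  rw [h] at this
  exact Subtype.ext this.symm

theorem IsHighestGenerated.isSemisimpleModule (hZ : HasCentralCharge q M z) {n : ℤ}
    (h : IsHighestGenerated q M n) : IsSemisimpleModule (Uq q) M := by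
  refine IsSemisimpleModule.of_sSup_simples_eq_top ?_
  rw [eq_top_iff, ← h, Submodule.span_le]
  intro v hv
  obtain ⟨b, hb⟩ := Set.mem_iUnion.1 hv
  by_cases hv0 : v = 0
  · rw [hv0]; exact Submodule.zero_mem _
  have hinj := vermaLift_injective hq0 hq hz hZ ⟨v, hb⟩ (by simpa using hv0)
  have := isSimpleModule_verma hq0 hq hz (blockWeight n b)
  have hs : IsSimpleModule (Uq q) (LinearMap.range (vermaLift hZ ⟨v, hb⟩)) :=
    IsSimpleModule.congr (LinearEquiv.ofInjective _ hinj).symm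
  exact le_sSup (a := LinearMap.range (vermaLift hZ ⟨v, hb⟩)) hs
    ⟨highestVector _ _ _, vermaLift_highestVector hZ ⟨v, hb⟩⟩

/-- A simple quotient of a module generated by highest weight vectors is a Verma module. -/
theorem IsHighestGenerated.exists_equiv_verma {n : ℤ} (h : IsHighestGenerated q M n)
    {S : Type} [AddCommGroup S] [Module ℂ S] [Module (Uq q) S] [IsScalarTower ℂ (Uq q) S]
    [IsSimpleModule (Uq q) S] (hZ : HasCentralCharge q S z) {f : M →ₗ[Uq q] S}
    (hf : f ≠ 0) : ∃ b, Nonempty (S ≃ₗ[Uq q] Verma q (q ^ blockWeight n b) z) := by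
  by_contra! hcon
  refine hf (LinearMap.ker_eq_top.1 (eq_top_iff.2 ?_))
  rw [← h, Submodule.span_le]
  intro v hv
  obtain ⟨b, hb⟩ := Set.mem_iUnion.1 hv
  by_contra hv0
  have := isSimpleModule_verma hq0 hq hz (blockWeight n b)
  have hinj := vermaLift_injective hq0 hq hz hZ ⟨f v, map_mem_highestWeightSpace f hb⟩ (by
    intro h0; exact hv0 (congrArg Subtype.val h0))
  have hbij : Function.Bijective
      (vermaLift (z := z) hZ ⟨f v, map_mem_highestWeightSpace f hb⟩) := by
    refine (LinearMap.bijective_or_eq_zero _).resolve_right fun h0 => ?_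
    rw [h0] at hinj
    exact highestVector_ne_zero hq0 (hq 2 (by norm_num)) (zpow_ne_zero _ hq0) hz
      (hinj (by simp : (0 : Verma q (q ^ blockWeight n b) z →ₗ[Uq q] S)
        (highestVector _ _ _) = (0 : Verma q (q ^ blockWeight n b) z →ₗ[Uq q] S) 0))
  exact (hcon b).false (LinearEquiv.ofBijective _ hbij).symm

theorem isInBlock_verma (n : ℤ) (b : Bool) :
    IsInBlock q (Verma q (q ^ blockWeight n b) z) (centralValue q (q ^ n) z) z :=
  isInBlock_of_isHighestGenerated hq0 hq hz hasCentralCharge_verma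
    (isHighestGenerated_verma n b)

theorem IsInGenBlock.exists_equiv_verma [IsSimpleModule (Uq q) M] {n : ℤ}
    (hM : IsInGenBlock q M (centralValue q (q ^ n) z) z) :
    ∃ b, Nonempty (M ≃ₗ[Uq q] Verma q (q ^ blockWeight n b) z) := by
  have := IsSimpleModule.nontrivial (Uq q) M
  have hZ := hM.hasCentralCharge
  exact (hM.isHighestGenerated hq0 hq hz hZ).exists_equiv_verma hq0 hq hz hZ
    (f := LinearMap.id) (by
      intro h
      obtain ⟨v, hv⟩ := exists_ne (0 : M)
      exact hv (congrArg (fun f : M →ₗ[Uq q] M => f v) h))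

/-- A finitely generated semisimple module is a finite sum of simple ones, and each summand is a
quotient of `M`, so it is a Verma module. -/
theorem IsHighestGenerated.exists_equiv_pi [Module.Finite (Uq q) M] (hZ : HasCentralCharge q M z)
    {n : ℤ} (h : IsHighestGenerated q M n) : ∃ (k : ℕ) (p : Fin k → Bool),
      Nonempty (M ≃ₗ[Uq q] ∀ i, Verma q (q ^ blockWeight n (p i)) z) := by
  have := h.isSemisimpleModule hq0 hq hz hZ
  obtain ⟨k, S, e, hS⟩ := IsSemisimpleModule.exists_linearEquiv_fin_dfinsupp (Uq q) M
  have hV : ∀ i, ∃ b, Nonempty (S i ≃ₗ[Uq q] Verma q (q ^ blockWeight n b) z) := by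
    intro i
    have hZi : HasCentralCharge q (S i) z := fun v => Subtype.ext (hZ v)
    have := hS i
    have := IsSimpleModule.nontrivial (Uq q) (S i)
    refine h.exists_equiv_verma hq0 hq hz hZi (f := DFinsupp.lapply i ∘ₗ e.toLinearMap) fun h0 => ?_
    obtain ⟨v, hv⟩ := exists_ne (0 : S i)
    refine hv ?_
    have h1 := congrArg (fun f : M →ₗ[Uq q] S i => f (e.symm (DFinsupp.single i v))) h0
    simpa using h1
  choose p hp using hV
  exact ⟨k, p, ⟨e.trans ((DFinsupp.linearEquivFunOnFintype (R := Uq q)).trans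
    (LinearEquiv.piCongrRight fun i => (hp i).some))⟩⟩

end Criterion

theorem blockWeight_injective (n : ℤ) : Function.Injective (blockWeight n) := by
  intro a b h
  cases a <;> cases b <;> simp only [blockWeight] at h <;> first | rfl | (exfalso; omega)

/-! ### The two Verma modules of a block. -/

section BlockVerma

/-- The two Verma modules in the block of `Δ(q ^ n, z)`. -/
def BlockVerma (q z : ℂ) (n : ℤ) (b : Bool) : Type := Verma q (q ^ blockWeight n b) z

variable {q z : ℂ} {n : ℤ} {b b' : Bool}

instance : AddCommGroup (BlockVerma q z n b) :=
  inferInstanceAs (AddCommGroup (Verma q (q ^ blockWeight n b) z))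

instance : Module ℂ (BlockVerma q z n b) :=
  inferInstanceAs (Module ℂ (Verma q (q ^ blockWeight n b) z))

instance : Module (Uq q) (BlockVerma q z n b) :=
  inferInstanceAs (Module (Uq q) (Verma q (q ^ blockWeight n b) z))

instance : IsScalarTower ℂ (Uq q) (BlockVerma q z n b) :=
  inferInstanceAs (IsScalarTower ℂ (Uq q) (Verma q (q ^ blockWeight n b) z))

instance : Module.Finite (Uq q) (BlockVerma q z n b) :=
  inferInstanceAs (Module.Finite (Uq q) (Verma q (q ^ blockWeight n b) z))

/-- The generating highest weight vector of `BlockVerma q z n b`. -/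
def blockVector (q z : ℂ) (n : ℤ) (b : Bool) : BlockVerma q z n b := highestVector _ _ _

theorem blockVector_mem :
    blockVector q z n b ∈ highestWeightSpace q (BlockVerma q z n b) (q ^ blockWeight n b) :=
  highestVector_mem

theorem span_blockVector : Submodule.span (Uq q) {blockVector q z n b} = ⊤ :=
  span_highestVector

theorem hasCentralCharge_blockVerma : HasCentralCharge q (BlockVerma q z n b) z :=
  hasCentralCharge_verma

theorem exists_blockVerma_hom {M : Type} [AddCommGroup M] [Module ℂ M] [Module (Uq q) M]
    [IsScalarTower ℂ (Uq q) M] (hZ : HasCentralCharge q M z)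
    (v : highestWeightSpace q M (q ^ blockWeight n b)) :
    ∃ f : BlockVerma q z n b →ₗ[Uq q] M, f (blockVector q z n b) = v :=
  ⟨vermaLift hZ v, vermaLift_highestVector hZ v⟩

theorem blockVector_ne_zero (hq0 : q ≠ 0) (hq : ∀ k : ℕ, 0 < k → q ^ k ≠ 1) (hz : z ≠ 0) :
    blockVector q z n b ≠ 0 :=
  highestVector_ne_zero hq0 (hq 2 (by norm_num)) (zpow_ne_zero _ hq0) hz

/-- This is the computation of Hom between the two Verma modules: scalars on the diagonal, zero off
it. -/
theorem eq_smul_blockVector (hq0 : q ≠ 0) (hq : ∀ k : ℕ, 0 < k → q ^ k ≠ 1) (hz : z ≠ 0)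
    {u : BlockVerma q z n b'}
    (hu : u ∈ highestWeightSpace q (BlockVerma q z n b') (q ^ blockWeight n b))
    (hu0 : u ≠ 0) : b = b' ∧ ∃ a : ℂ, a • blockVector q z n b' = u := by
  obtain rfl := blockWeight_injective n
    (weight_eq_of_mem_highestWeightSpace_verma hq0 hq hz hu0 hu)
  exact ⟨rfl, Submodule.mem_span_singleton.1 ((highestWeightSpace_verma hq0 hq hz _).le hu)⟩

theorem IsHighestGenerated.exists_equiv_pi_blockVerma {M : Type} [AddCommGroup M] [Module ℂ M]
    [Module (Uq q) M] [IsScalarTower ℂ (Uq q) M] [Module.Finite (Uq q) M]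
    (hq0 : q ≠ 0) (hq : ∀ k : ℕ, 0 < k → q ^ k ≠ 1) (hz : z ≠ 0)
    (hZ : HasCentralCharge q M z) (h : IsHighestGenerated q M n) : ∃ (k : ℕ) (p : Fin k → Bool),
      Nonempty (M ≃ₗ[Uq q] ∀ i, BlockVerma q z n (p i)) :=
  h.exists_equiv_pi hq0 hq hz hZ

end BlockVerma

/-! ### Functoriality of highest weight vectors. -/

section Transport

variable {q : ℂ} {M N : Type} [AddCommGroup M] [Module ℂ M] [Module (Uq q) M]
  [IsScalarTower ℂ (Uq q) M] [AddCommGroup N] [Module ℂ N] [Module (Uq q) N]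
  [IsScalarTower ℂ (Uq q) N] {z : ℂ}

/-- The map on highest weight vectors induced by a homomorphism. -/
def highestWeightMap (f : M →ₗ[Uq q] N) (l : ℂ) :
    highestWeightSpace q M l →ₗ[ℂ] highestWeightSpace q N l :=
  (f.restrictScalars ℂ).restrict fun _ hx => map_mem_highestWeightSpace f hx

/-- The equivalence of highest weight spaces induced by an isomorphism. -/
def highestWeightEquiv (e : M ≃ₗ[Uq q] N) (l : ℂ) :
    highestWeightSpace q M l ≃ₗ[ℂ] highestWeightSpace q N l :=
  LinearEquiv.ofLinearMap (highestWeightMap e.toLinearMap l) (highestWeightMap e.symm.toLinearMap l)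
    (LinearMap.ext fun x => Subtype.ext (e.apply_symm_apply x))
    (LinearMap.ext fun x => Subtype.ext (e.symm_apply_apply x))

theorem HasCentralCharge.of_equiv (h : HasCentralCharge q N z) (e : M ≃ₗ[Uq q] N) :
    HasCentralCharge q M z := fun v => e.injective (by
  rw [map_smul, h, ← algebraMap_smul (Uq q) z v, map_smul, algebraMap_smul])

theorem IsHighestGenerated.of_equiv {n : ℤ} (h : IsHighestGenerated q N n) (e : M ≃ₗ[Uq q] N) :
    IsHighestGenerated q M n := by
  rw [IsHighestGenerated, eq_top_iff]
  intro x _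
  have hx : e x ∈ Submodule.span (Uq q)
      (⋃ b, (highestWeightSpace q N (q ^ blockWeight n b) : Set N)) := by rw [h]; trivial
  have key : Submodule.span (Uq q)
      (⋃ b, (highestWeightSpace q N (q ^ blockWeight n b) : Set N)) ≤
      (Submodule.span (Uq q) (⋃ b, (highestWeightSpace q M (q ^ blockWeight n b) : Set M))).comap
        e.symm.toLinearMap := by
    refine Submodule.span_le.2 fun y hy => Submodule.subset_span ?_
    obtain ⟨b, hb⟩ := Set.mem_iUnion.1 hy
    exact Set.mem_iUnion.2 ⟨b, map_mem_highestWeightSpace e.symm.toLinearMap hb⟩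
  simpa using key hx

end Transport

/-! ### Homomorphisms and bases in terms of highest weight vectors. -/

section Structure

variable {q : ℂ} {M : Type} [AddCommGroup M] [Module ℂ M] [Module (Uq q) M]
  [IsScalarTower ℂ (Uq q) M] {z : ℂ}

theorem IsHighestGenerated.hom_ext {N : Type} [AddCommGroup N] [Module (Uq q) N] {n : ℤ}
    (h : IsHighestGenerated q M n) {f g : M →ₗ[Uq q] N}
    (hfg : ∀ b, ∀ x ∈ highestWeightSpace q M (q ^ blockWeight n b), f x = g x) : f = g :=
  LinearMap.ext_on h fun x hx => by
    obtain ⟨b, hb⟩ := Set.mem_iUnion.1 hx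
    exact hfg b x hb

theorem hasCentralCharge_pi {ι : Type} {V : ι → Type} [∀ i, AddCommGroup (V i)]
    [∀ i, Module ℂ (V i)] [∀ i, Module (Uq q) (V i)] (h : ∀ i, HasCentralCharge q (V i) z) :
    HasCentralCharge q (∀ i, V i) z :=
  fun v => funext fun i => h i (v i)

theorem isHighestGenerated_pi_blockVerma {ι : Type} [Fintype ι] [DecidableEq ι] (n : ℤ)
    (p : ι → Bool) : IsHighestGenerated q (∀ i, BlockVerma q z n (p i)) n := by
  rw [IsHighestGenerated, eq_top_iff]
  intro x _
  rw [← Finset.univ_sum_single x]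
  refine Submodule.sum_mem _ fun i _ => ?_
  have hx : x i ∈ Submodule.span (Uq q) {blockVector q z n (p i)} := by
    rw [span_blockVector]; trivial
  obtain ⟨a, ha⟩ := Submodule.mem_span_singleton.1 hx
  rw [← ha, Pi.single_smul]
  refine Submodule.smul_mem _ _ (Submodule.subset_span (Set.mem_iUnion.2 ⟨p i, ?_⟩))
  exact map_mem_highestWeightSpace (LinearMap.single (Uq q) (fun i =>
    BlockVerma q z n (p i)) i) blockVector_mem

/-- The product of `d b` copies of the Verma module of highest weight `q ^ blockWeight n b`, for
both values of `b`. -/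
abbrev PiVerma (q z : ℂ) (n : ℤ) (d : Bool → ℕ) : Type :=
  ∀ i : (b : Bool) × Fin (d b), BlockVerma q z n i.1

/-- The highest weight vector of a factor of `PiVerma q z n d`. -/
def piHighestVector (q z : ℂ) (n : ℤ) (d : Bool → ℕ) (b : Bool) (j : Fin (d b)) :
    highestWeightSpace q (PiVerma q z n d) (q ^ blockWeight n b) :=
  ⟨Pi.single ⟨b, j⟩ (blockVector q z n b),
    map_mem_highestWeightSpace (LinearMap.single (Uq q) (fun i : (b : Bool) × Fin (d b) =>
      BlockVerma q z n i.1) ⟨b, j⟩) blockVector_mem⟩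

theorem piHighestVector_val (n : ℤ) (d : Bool → ℕ) (b : Bool) (j : Fin (d b)) :
    (piHighestVector q z n d b j).1 = Pi.single ⟨b, j⟩ (blockVector q z n b) := rfl

theorem sum_piHighestVector_apply (n : ℤ) (d : Bool → ℕ) (b : Bool) (c : Fin (d b) → ℂ)
    (j : Fin (d b)) : (∑ k, c k • piHighestVector q z n d b k).1 ⟨b, j⟩ =
      c j • blockVector q z n b := by
  rw [Submodule.coe_sum, Finset.sum_apply, Finset.sum_eq_single j]
  · rw [Submodule.coe_smul, Pi.smul_apply, piHighestVector_val, Pi.single_eq_same]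
  · intro k _ hk
    have : (⟨b, j⟩ : (b : Bool) × Fin (d b)) ≠ ⟨b, k⟩ := fun h => hk (by simpa using h.symm)
    rw [Submodule.coe_smul, Pi.smul_apply, piHighestVector_val, Pi.single_eq_of_ne this, smul_zero]
  · simp

theorem sum_piHighestVector_apply_of_ne (n : ℤ) (d : Bool → ℕ) {b b' : Bool} (hb : b' ≠ b)
    (c : Fin (d b) → ℂ) (j : Fin (d b')) :
    (∑ k, c k • piHighestVector q z n d b k).1 ⟨b', j⟩ = 0 := by
  rw [Submodule.coe_sum, Finset.sum_apply]
  refine Finset.sum_eq_zero fun k _ => ?_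
  have : (⟨b', j⟩ : (b : Bool) × Fin (d b)) ≠ ⟨b, k⟩ := fun h => hb (congrArg Sigma.fst h)
  rw [Submodule.coe_smul, Pi.smul_apply, piHighestVector_val, Pi.single_eq_of_ne this, smul_zero]

variable (hq0 : q ≠ 0) (hq : ∀ k : ℕ, 0 < k → q ^ k ≠ 1) (hz : z ≠ 0)
include hq0 hq hz

/-- In a finite product of Verma modules each component of such a vector lies on the line of the
generator. -/
theorem IsHighestGenerated.finite_highestWeightSpace [Module.Finite (Uq q) M]
    (hZ : HasCentralCharge q M z) {n : ℤ} (h : IsHighestGenerated q M n) (b : Bool) :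
    Module.Finite ℂ (highestWeightSpace q M (q ^ blockWeight n b)) := by
  obtain ⟨k, p, ⟨e⟩⟩ := h.exists_equiv_pi_blockVerma hq0 hq hz hZ
  let g : highestWeightSpace q M (q ^ blockWeight n b) →ₗ[ℂ]
      ∀ i, Submodule.span ℂ {blockVector q z n (p i)} :=
    LinearMap.pi fun i => LinearMap.codRestrict _
      (((LinearMap.proj i ∘ₗ e.toLinearMap).restrictScalars ℂ) ∘ₗ Submodule.subtype _) fun x => by
        have hx := map_mem_highestWeightSpace (LinearMap.proj i ∘ₗ e.toLinearMap) x.2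
        by_cases h0 : (LinearMap.proj i ∘ₗ e.toLinearMap : M →ₗ[Uq q] _) x = 0
        · exact (Submodule.mem_bot ℂ).2 h0 ▸ Submodule.zero_mem _
        · exact Submodule.mem_span_singleton.2
            (eq_smul_blockVector hq0 hq hz hx h0).2
  have h1 : ∀ i, Module.Finite ℂ
      (Submodule.span ℂ {blockVector q z n (p i)}) := fun i =>
    FiniteDimensional.span_singleton ℂ _
  have h2 : IsNoetherian ℂ
      (∀ i, Submodule.span ℂ {blockVector q z n (p i)}) :=
    isNoetherian_pi
  refine Module.Finite.of_injective g fun x y hxy => Subtype.ext (e.injective (funext fun i => ?_))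
  exact congrArg Subtype.val (congrFun hxy i)

/-- This gives fullness of the functor. On each Verma summand the universal property extends φ from
the generator; the homomorphisms are then added up. -/
theorem IsHighestGenerated.exists_extension [Module.Finite (Uq q) M]
    (hZ : HasCentralCharge q M z) {n : ℤ} (h : IsHighestGenerated q M n)
    {N : Type} [AddCommGroup N] [Module ℂ N] [Module (Uq q) N] [IsScalarTower ℂ (Uq q) N]
    (hN : HasCentralCharge q N z)
    (φ : ∀ b, highestWeightSpace q M (q ^ blockWeight n b) →ₗ[ℂ]
      highestWeightSpace q N (q ^ blockWeight n b)) :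
    ∃ f : M →ₗ[Uq q] N, ∀ b (x : highestWeightSpace q M (q ^ blockWeight n b)),
      f x = φ b x := by
  obtain ⟨k, p, ⟨e⟩⟩ := h.exists_equiv_pi_blockVerma hq0 hq hz hZ
  let s : ∀ i, BlockVerma q z n (p i) →ₗ[Uq q] M := fun i =>
    e.symm.toLinearMap ∘ₗ LinearMap.single (Uq q) (fun i => BlockVerma q z n (p i)) i
  let t : ∀ i, M →ₗ[Uq q] BlockVerma q z n (p i) := fun i =>
    LinearMap.proj i ∘ₗ e.toLinearMap
  have hst : ∀ x, ∑ i, s i (t i x) = x := by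
    intro x
    have := Finset.univ_sum_single (e x)
    simp only [s, t, LinearMap.comp_apply, LinearEquiv.coe_coe, LinearMap.proj_apply,
      LinearMap.coe_single]
    rw [← map_sum, this, e.symm_apply_apply]
  let w : ∀ i, highestWeightSpace q N (q ^ blockWeight n (p i)) := fun i =>
    φ (p i) ⟨s i (blockVector _ _ _ _), map_mem_highestWeightSpace (s i) blockVector_mem⟩
  choose g hg using fun i => exists_blockVerma_hom hN (w i)
  -- Each `g i` agrees with φ ∘ `s i` on all highest weight vectors of the block's weights, since
  -- these are multiples of the generator or zero.
  refine ⟨∑ i, g i ∘ₗ t i, fun b x => ?_⟩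
  have key : ∀ i y (hy : y ∈ highestWeightSpace q (BlockVerma q z n (p i))
      (q ^ blockWeight n b)), g i y =
        φ b ⟨s i y, map_mem_highestWeightSpace (s i) hy⟩ := by
    intro i y hti
    by_cases hy : y = 0
    · subst hy
      have : (⟨s i 0, map_mem_highestWeightSpace (s i) hti⟩ :
          highestWeightSpace q M (q ^ blockWeight n b)) = 0 := Subtype.ext (map_zero _)
      rw [map_zero, this, map_zero]
      rfl
    · obtain ⟨rfl, a, rfl⟩ := eq_smul_blockVector hq0 hq hz hti hy
      have h1 : (⟨s i (a • blockVector _ _ _ _), map_mem_highestWeightSpace (s i) hti⟩ :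
          highestWeightSpace q M (q ^ blockWeight n (p i))) = a • ⟨s i (blockVector _ _ _ _),
            map_mem_highestWeightSpace (s i) blockVector_mem⟩ :=
        Subtype.ext (by
          change s i (a • _) = a • s i _
          rw [← algebraMap_smul (Uq q), map_smul, algebraMap_smul])
      rw [h1, (φ (p i)).map_smul, ← algebraMap_smul (Uq q) a (blockVector q z n (p i)), map_smul,
        hg, algebraMap_smul]
      rfl
  rw [LinearMap.sum_apply]
  simp only [LinearMap.comp_apply, key _ _ (map_mem_highestWeightSpace (t _) x.2)]
  rw [← Submodule.coe_sum, ← map_sum]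
  congr 2
  refine Subtype.ext ?_
  rw [Submodule.coe_sum]
  exact hst x

theorem exists_sum_piHighestVector (n : ℤ) (d : Bool → ℕ) (b : Bool)
    (x : highestWeightSpace q (PiVerma q z n d) (q ^ blockWeight n b)) :
    ∃ c : Fin (d b) → ℂ, x = ∑ k, c k • piHighestVector q z n d b k := by
  have hx : ∀ i : (b : Bool) × Fin (d b), x.1 i ∈ highestWeightSpace q
      (BlockVerma q z n i.1) (q ^ blockWeight n b) := fun i =>
    map_mem_highestWeightSpace (LinearMap.proj (R := Uq q)
      (φ := fun i : (b : Bool) × Fin (d b) => BlockVerma q z n i.1) i) x.2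
  have hx' : ∀ j, ∃ a : ℂ, a • blockVector q z n b = x.1 ⟨b, j⟩ := by
    intro j
    by_cases h0 : x.1 ⟨b, j⟩ = 0
    · exact ⟨0, by rw [h0, zero_smul]⟩
    · exact (eq_smul_blockVector hq0 hq hz (hx ⟨b, j⟩) h0).2
  choose c hc using hx'
  refine ⟨c, Subtype.ext (funext fun ⟨b', j⟩ => ?_)⟩
  by_cases hb : b' = b
  · subst hb
    rw [sum_piHighestVector_apply, hc]
  · rw [sum_piHighestVector_apply_of_ne n d hb]
    by_contra h0
    exact hb (eq_smul_blockVector hq0 hq hz (hx ⟨b', j⟩) h0).1.symm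

/-- The highest weight vectors of the factors form a basis of the space of highest weight vectors
of `PiVerma q z n d`. -/
def piVermaBasis (n : ℤ) (d : Bool → ℕ) (b : Bool) :
    Module.Basis (Fin (d b)) ℂ (highestWeightSpace q (PiVerma q z n d) (q ^ blockWeight n b)) :=
  Module.Basis.mk (v := piHighestVector q z n d b)
    (Fintype.linearIndependent_iff.2 fun c hc j => by
      have h := sum_piHighestVector_apply (q := q) (z := z) n d b c j
      rw [hc] at h
      exact (smul_eq_zero.1 h.symm).resolve_right
        (blockVector_ne_zero hq0 hq hz))
    (by
      rintro x -
      obtain ⟨c, rfl⟩ := exists_sum_piHighestVector hq0 hq hz n d b x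
      exact Submodule.sum_mem _ fun k _ => Submodule.smul_mem _ _ (Submodule.subset_span ⟨k, rfl⟩))

end Structure

/-! ### Modules over ℂ × ℂ as pairs of vector spaces. -/

section PairModule

/-- The `ℂ × ℂ`-module with components `A` and `B`. -/
def PairModule (A B : Type) : Type := A × B

variable {A B A' B' : Type} [AddCommGroup A] [Module ℂ A] [AddCommGroup B] [Module ℂ B]
  [AddCommGroup A'] [Module ℂ A'] [AddCommGroup B'] [Module ℂ B']

instance : AddCommGroup (PairModule A B) := inferInstanceAs (AddCommGroup (A × B))

instance : Module ℂ (PairModule A B) := inferInstanceAs (Module ℂ (A × B))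

instance : Module (ℂ × ℂ) (PairModule A B) where
  smul a x := (a.1 • x.1, a.2 • x.2)
  one_smul x := Prod.ext (one_smul ℂ x.1) (one_smul ℂ x.2)
  mul_smul a b x := Prod.ext (mul_smul a.1 b.1 x.1) (mul_smul a.2 b.2 x.2)
  smul_zero a := Prod.ext (smul_zero a.1) (smul_zero a.2)
  smul_add a x y := Prod.ext (smul_add a.1 x.1 y.1) (smul_add a.2 x.2 y.2)
  add_smul a b x := Prod.ext (add_smul a.1 b.1 x.1) (add_smul a.2 b.2 x.2)
  zero_smul x := Prod.ext (zero_smul ℂ x.1) (zero_smul ℂ x.2)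

theorem PairModule.smul_def (a : ℂ × ℂ) (x : PairModule A B) :
    a • x = (a.1 • x.1, a.2 • x.2) := rfl

instance : IsScalarTower ℂ (ℂ × ℂ) (PairModule A B) where
  smul_assoc a b x := Prod.ext (smul_assoc a b.1 x.1) (smul_assoc a b.2 x.2)

instance [Module.Finite ℂ A] [Module.Finite ℂ B] : Module.Finite (ℂ × ℂ) (PairModule A B) :=
  have : Module.Finite ℂ (PairModule A B) := inferInstanceAs (Module.Finite ℂ (A × B))
  Module.Finite.of_restrictScalars_finite ℂ (ℂ × ℂ) (PairModule A B)

/-- The map of pairs given by maps of the components. -/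
def PairModule.map (f : A →ₗ[ℂ] A') (g : B →ₗ[ℂ] B') :
    PairModule A B →ₗ[ℂ × ℂ] PairModule A' B' where
  toFun x := (f x.1, g x.2)
  map_add' x y := Prod.ext (f.map_add x.1 y.1) (g.map_add x.2 y.2)
  map_smul' a x := Prod.ext (f.map_smul a.1 x.1) (g.map_smul a.2 x.2)

theorem PairModule.exists_eq_map (φ : PairModule A B →ₗ[ℂ × ℂ] PairModule A' B') :
    ∃ (f : A →ₗ[ℂ] A') (g : B →ₗ[ℂ] B'), φ = PairModule.map f g := by
  -- Linearity over the idempotents (1, 0) and (0, 1) makes the map diagonal; linearity over (c, c)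
  -- then gives ℂ-linearity of its components.
  have h1 : ∀ x : PairModule A B, (φ x).1 = (φ (x.1, 0)).1 := fun x => by
    have := φ.map_smul (1, 0) x
    simpa [smul_def] using (congrArg Prod.fst this).symm
  have h2 : ∀ x : PairModule A B, (φ x).2 = (φ (0, x.2)).2 := fun x => by
    have := φ.map_smul (0, 1) x
    simpa [smul_def] using (congrArg Prod.snd this).symm
  refine ⟨{ toFun := fun a => (φ (a, 0)).1, map_add' := ?_, map_smul' := ?_ },
    { toFun := fun b => (φ (0, b)).2, map_add' := ?_, map_smul' := ?_ }, ?_⟩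
  · intro a b
    have := congrArg Prod.fst (φ.map_add (a, 0) (b, 0))
    rwa [h1] at this
  · intro c a
    have := congrArg Prod.fst (φ.map_smul (c, c) (a, 0))
    rwa [h1] at this
  · intro a b
    have := congrArg Prod.snd (φ.map_add (0, a) (0, b))
    rwa [h2] at this
  · intro c a
    have := congrArg Prod.snd (φ.map_smul (c, c) (0, a))
    rwa [h2] at this
  · exact LinearMap.ext fun x => Prod.ext (h1 x) (h2 x)

variable {V : Type} [AddCommGroup V] [Module ℂ V] [Module (ℂ × ℂ) V] [IsScalarTower ℂ (ℂ × ℂ) V]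

variable (V) in
/-- The image of an idempotent of `ℂ × ℂ`, as the space of vectors that it fixes. -/
def fixedSpace (e : ℂ × ℂ) : Submodule ℂ V where
  carrier := {v | e • v = v}
  add_mem' {a b} (ha : e • a = a) (hb : e • b = b) := by
    change e • (a + b) = a + b
    rw [smul_add, ha, hb]
  zero_mem' := smul_zero e
  smul_mem' c v (hv : e • v = v) := by
    change e • c • v = c • v
    rw [smul_algebra_smul_comm, hv]

/-- A `ℂ × ℂ`-module is the pair of the images of the two idempotents. -/
def PairModule.equivOfFixedSpace (α : A ≃ₗ[ℂ] fixedSpace V (1, 0))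
    (β : B ≃ₗ[ℂ] fixedSpace V (0, 1)) : PairModule A B ≃ₗ[ℂ × ℂ] V :=
  have hα : ∀ a, ((1, 0) : ℂ × ℂ) • (α a : V) = α a := fun a => (α a).2
  have hβ : ∀ b, ((0, 1) : ℂ × ℂ) • (β b : V) = β b := fun b => (β b).2
  have hα' : ∀ (c : ℂ × ℂ) a, c • (α a : V) = c.1 • (α a : V) := fun c a => by
    rw [← hα, ← mul_smul, ← smul_assoc]; congr 1; ext <;> simp
  have hβ' : ∀ (c : ℂ × ℂ) b, c • (β b : V) = c.2 • (β b : V) := fun c b => by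
    rw [← hβ, ← mul_smul, ← smul_assoc]; congr 1; ext <;> simp
  LinearEquiv.ofBijective
    { toFun := fun x => (α x.1 : V) + β x.2
      map_add' := fun x y => by
        change ((α (x.1 + y.1) : V) + β (x.2 + y.2)) = _
        rw [map_add, map_add, Submodule.coe_add, Submodule.coe_add]
        abel
      map_smul' := fun c x => by
        change ((α (c.1 • x.1) : V) + β (c.2 • x.2)) = c • ((α x.1 : V) + β x.2)
        rw [map_smul, map_smul, Submodule.coe_smul, Submodule.coe_smul, smul_add, hα', hβ'] }
    (by
      constructor
      · refine (injective_iff_map_eq_zero _).2 fun x hx => ?_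
        replace hx : (α x.1 : V) + β x.2 = 0 := hx
        have h1 := congrArg (((1, 0) : ℂ × ℂ) • ·) hx
        have h2 := congrArg (((0, 1) : ℂ × ℂ) • ·) hx
        simp only [smul_add, hα', hβ', smul_zero, one_smul, zero_smul, add_zero, zero_add] at h1 h2
        exact Prod.ext (α.map_eq_zero_iff.1 (Subtype.ext h1)) (β.map_eq_zero_iff.1 (Subtype.ext h2))
      · intro v
        obtain ⟨a, ha⟩ := α.surjective ⟨((1, 0) : ℂ × ℂ) • v, by
          change ((1, 0) : ℂ × ℂ) • ((1, 0) : ℂ × ℂ) • v = _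
          rw [← mul_smul]; congr 1; ext <;> simp⟩
        obtain ⟨b, hb⟩ := β.surjective ⟨((0, 1) : ℂ × ℂ) • v, by
          change ((0, 1) : ℂ × ℂ) • ((0, 1) : ℂ × ℂ) • v = _
          rw [← mul_smul]; congr 1; ext <;> simp⟩
        refine ⟨(a, b), ?_⟩
        change (α a : V) + β b = v
        rw [ha, hb]
        change ((1, 0) : ℂ × ℂ) • v + ((0, 1) : ℂ × ℂ) • v = v
        rw [← add_smul]
        convert one_smul (ℂ × ℂ) v
        simp [Prod.ext_iff])

end PairModule

/-! ### The equivalence of the block with finitely generated ℂ × ℂ-modules. -/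

section Equivalence

open scoped ModuleCat

/-- The functor of highest weight vectors of the two weights of a block. -/
def highestWeightFunctor (q : ℂ) (n : ℤ) : ModuleCat.{0} (Uq q) ⥤ ModuleCat.{0} (ℂ × ℂ) where
  obj M := ModuleCat.of (ℂ × ℂ) (PairModule (highestWeightSpace q M (q ^ blockWeight n true))
    (highestWeightSpace q M (q ^ blockWeight n false)))
  map f := ModuleCat.ofHom (PairModule.map (highestWeightMap f.hom _) (highestWeightMap f.hom _))
  map_id _ := rfl
  map_comp _ _ := rfl

variable {q z : ℂ} (hq0 : q ≠ 0) (hq : ∀ k : ℕ, 0 < k → q ^ k ≠ 1) (hz : z ≠ 0) (n : ℤ)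

include hq0 hq hz in
theorem isSemisimpleModule_block (M : Block q (centralValue q (q ^ n) z) z) :
    IsSemisimpleModule (Uq q) M.obj := by
  have hM : IsInBlock q M.obj (centralValue q (q ^ n) z) z := M.property
  exact (hM.toIsInGenBlock.isHighestGenerated hq0 hq hz
    hM.centralCharge).isSemisimpleModule hq0 hq hz hM.centralCharge

/-- The restriction of the functor of highest weight vectors to a block. -/
def blockFunctor : Block q (centralValue q (q ^ n) z) z ⥤ FGModuleCat.{0} (ℂ × ℂ) :=
  (ModuleCat.isFG (ℂ × ℂ)).lift (ObjectProperty.ι _ ⋙ highestWeightFunctor q n) fun M => by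
    have hM : IsInBlock q M.obj (centralValue q (q ^ n) z) z := M.property
    have hfin : Module.Finite (Uq q) M.obj := hM.inO.finite
    have h := fun b => (hM.toIsInGenBlock.isHighestGenerated hq0 hq hz
      hM.centralCharge).finite_highestWeightSpace hq0 hq hz hM.centralCharge b
    have h1 := h true
    have h2 := h false
    exact (inferInstance : Module.Finite (ℂ × ℂ)
      (PairModule (highestWeightSpace q M.obj (q ^ blockWeight n true))
        (highestWeightSpace q M.obj (q ^ blockWeight n false))))

/-- Highest weight vectors of the two weights generate, so they determine a homomorphism. -/
instance : (blockFunctor hq0 hq hz n).Faithful where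
  map_injective {M N} f g hfg := by
    have hM : IsInBlock q M.obj (centralValue q (q ^ n) z) z := M.property
    have hgen := hM.toIsInGenBlock.isHighestGenerated hq0 hq hz hM.centralCharge
    refine ObjectProperty.hom_ext _ (ModuleCat.hom_ext (hgen.hom_ext fun b x hx => ?_))
    have h : PairModule.map (highestWeightMap f.hom.hom (q ^ blockWeight n true))
        (highestWeightMap f.hom.hom (q ^ blockWeight n false)) =
        PairModule.map (highestWeightMap g.hom.hom (q ^ blockWeight n true))
        (highestWeightMap g.hom.hom (q ^ blockWeight n false)) :=
      congrArg (fun k => k.hom.hom) hfg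
    cases b with
    | true => exact congrArg (fun y => (y.1 : N.obj)) (LinearMap.congr_fun h (⟨x, hx⟩, 0))
    | false => exact congrArg (fun y => (y.2 : N.obj)) (LinearMap.congr_fun h (0, ⟨x, hx⟩))

instance : (blockFunctor hq0 hq hz n).Full where
  map_surjective {M N} φ := by
    have hM : IsInBlock q M.obj (centralValue q (q ^ n) z) z := M.property
    have hN : IsInBlock q N.obj (centralValue q (q ^ n) z) z := N.property
    have hfin : Module.Finite (Uq q) M.obj := hM.inO.finite
    have hgen := hM.toIsInGenBlock.isHighestGenerated hq0 hq hz hM.centralCharge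
    obtain ⟨f, g, hfg⟩ := PairModule.exists_eq_map
      (A := highestWeightSpace q M.obj (q ^ blockWeight n true))
      (B := highestWeightSpace q M.obj (q ^ blockWeight n false))
      (A' := highestWeightSpace q N.obj (q ^ blockWeight n true))
      (B' := highestWeightSpace q N.obj (q ^ blockWeight n false)) φ.hom.hom
    obtain ⟨F, hF⟩ := hgen.exists_extension hq0 hq hz hM.centralCharge hN.centralCharge
      (fun b => match b with
        | true => f
        | false => g)
    refine ⟨ObjectProperty.homMk (ModuleCat.ofHom F), ?_⟩
    refine ObjectProperty.hom_ext _ (ModuleCat.hom_ext ?_)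
    refine Eq.trans ?_ hfg.symm
    exact LinearMap.ext fun x => Prod.ext (Subtype.ext (hF true x.1)) (Subtype.ext (hF false x.2))

/-- The preimage of `V` is a product of Verma modules, whose multiplicities are the dimensions of
the images of the two idempotents. -/
instance : (blockFunctor hq0 hq hz n).EssSurj where
  mem_essImage V := by
    have hV : Module.Finite (ℂ × ℂ) V.obj := V.property
    have hfin : Module.Finite ℂ V.obj := Module.Finite.trans (ℂ × ℂ) V.obj
    have hst : IsScalarTower ℂ (ℂ × ℂ) V.obj := inferInstance
    let S : Bool → Submodule ℂ V.obj := fun b =>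
      match b with
      | true => fixedSpace V.obj (1, 0)
      | false => fixedSpace V.obj (0, 1)
    let d : Bool → ℕ := fun b => Module.finrank ℂ (S b)
    let P := ModuleCat.of (Uq q) (PiVerma q z n d)
    let eP : P ≃ₗ[Uq q] PiVerma q z n d := LinearEquiv.refl _ _
    have hZ : HasCentralCharge q P z :=
      (hasCentralCharge_pi fun _ => hasCentralCharge_blockVerma).of_equiv eP
    have hgen : IsHighestGenerated q P n := (isHighestGenerated_pi_blockVerma n _).of_equiv eP
    have hP : Module.Finite (Uq q) P := inferInstanceAs (Module.Finite (Uq q) (PiVerma q z n d))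
    have hblock : IsInBlock q P (centralValue q (q ^ n) z) z :=
      isInBlock_of_isHighestGenerated hq0 hq hz hZ hgen
    -- The generators of the `d b` factors are matched with a basis of the image of the
    -- corresponding idempotent.
    let e := fun b => (highestWeightEquiv eP _).trans
      ((piVermaBasis hq0 hq hz n d b).equiv (Module.finBasis ℂ (S b)) (Equiv.refl _))
    refine ⟨⟨P, hblock⟩, ⟨ObjectProperty.isoMk _ (LinearEquiv.toModuleIso ?_)⟩⟩
    exact PairModule.equivOfFixedSpace (A := highestWeightSpace q P (q ^ blockWeight n true))
      (B := highestWeightSpace q P (q ^ blockWeight n false)) (e true) (e false)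

instance : (blockFunctor hq0 hq hz n).IsEquivalence where

instance : (blockFunctor hq0 hq hz n).Additive where
  map_add := rfl

instance : (blockFunctor hq0 hq hz n).Linear ℂ where
  map_smul f r := by
    refine ObjectProperty.hom_ext _ (ModuleCat.hom_ext (LinearMap.ext fun x => ?_))
    rfl

end Equivalence

end QuantumSchrodinger

end

theorem mainTheorem6 (q : ℂ) (hq0 : q ≠ 0) (hq : ∀ k : ℕ, 0 < k → q ^ k ≠ 1)
    (z : ℂ) (hz : z ≠ 0) :
    (∀ n : ℤ, IsSimpleModule (QuantumSchrodinger.Uq q) (QuantumSchrodinger.Verma q (q ^ n) z)) ∧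
    (∀ n : ℤ,
      QuantumSchrodinger.IsInBlock q (QuantumSchrodinger.Verma q (q ^ n) z)
        (QuantumSchrodinger.centralValue q (q ^ n) z) z ∧
      QuantumSchrodinger.IsInBlock q (QuantumSchrodinger.Verma q (q ^ (-n - 3)) z)
        (QuantumSchrodinger.centralValue q (q ^ n) z) z ∧
      IsEmpty (QuantumSchrodinger.Verma q (q ^ n) z ≃ₗ[QuantumSchrodinger.Uq q]
        QuantumSchrodinger.Verma q (q ^ (-n - 3)) z) ∧
      ∀ (M : Type) [AddCommGroup M] [Module ℂ M] [Module (QuantumSchrodinger.Uq q) M]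
        [IsScalarTower ℂ (QuantumSchrodinger.Uq q) M],
        QuantumSchrodinger.IsInGenBlock q M (QuantumSchrodinger.centralValue q (q ^ n) z) z →
        IsSimpleModule (QuantumSchrodinger.Uq q) M →
        Nonempty (M ≃ₗ[QuantumSchrodinger.Uq q] QuantumSchrodinger.Verma q (q ^ n) z) ∨
        Nonempty (M ≃ₗ[QuantumSchrodinger.Uq q] QuantumSchrodinger.Verma q (q ^ (-n - 3)) z)) ∧
    (∀ n : ℤ,
      (∀ M : QuantumSchrodinger.Block q (QuantumSchrodinger.centralValue q (q ^ n) z) z,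
        IsSemisimpleModule (QuantumSchrodinger.Uq q) M.obj) ∧
      ∃ e : QuantumSchrodinger.Block q (QuantumSchrodinger.centralValue q (q ^ n) z) z ≌
          FGModuleCat.{0} (ℂ × ℂ),
        e.functor.Additive ∧ e.functor.Linear ℂ) := by
  have key := fun n => @QuantumSchrodinger.isInBlock_verma q z hq0 hq hz n
  refine ⟨fun n => QuantumSchrodinger.isSimpleModule_verma hq0 hq hz n, fun n =>
    ⟨key n true, key n false, QuantumSchrodinger.isEmpty_verma_equiv hq0 hq hz n, ?_⟩, fun n =>
    ⟨fun M => ?_, (QuantumSchrodinger.blockFunctor hq0 hq hz n).asEquivalence, ?_, ?_⟩⟩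
  · intro M _ _ _ _ hM _
    obtain ⟨b, hb⟩ := hM.exists_equiv_verma hq0 hq hz
    cases b with
    | true => exact Or.inl hb
    | false => exact Or.inr hb
  · exact QuantumSchrodinger.isSemisimpleModule_block hq0 hq hz n M
  · exact inferInstanceAs (QuantumSchrodinger.blockFunctor hq0 hq hz n).Additive
  · exact inferInstanceAs ((QuantumSchrodinger.blockFunctor hq0 hq hz n).Linear ℂ)
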